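/- Let $q$ be a real-valued $C^\infty$ function on a neighbourhood of $[0,1]$, and consider the Dirichlet eigenvalue problem $$-y''(x)+q(x)\,y(x)=\lambda\,y(x)\ \text{ in } ]0,1[,\qquad y(0)=y(1)=0 .$$ Let $\lambda_1<\lambda_2<\cdots$ be its eigenvalues in increasing order (so exactly $k$ eigenvalues are $\le\lambda_k$), let $1\le m\le n$ be integers, and for $m\le k\le n$ let $h_k$ be an eigenfunction for $\lambda_k$ (for instance one normalized in $L^2(0,1)$). Let $a_m,\dots,a_n$ be real numbers, not all zero, and let $U=\sum_{k=m}^n a_k h_k$. Then: (a) $U$ has at most $n-1$ zeros in $]0,1[$, counted with multiplicities, where the multiplicity of a zero $x$ is its order of vanishing, i.e. the supremum of the integers $p$ with $U(x)=U'(x)=\dots=U^{(p-1)}(x)=0$; (b) $U$ changes sign at least $m-1$ times in $]0,1[$: there are at least $m-1$ points $z\in\,]0,1[$ with $U(z)=0$ such that $U$ has a strict constant sign immediately to the left of $z$ and the opposite strict sign immediately to the right of $z$. -/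

import Mathlib

open Set Filter Topology
open scoped ContDiff

/-- `y` is an eigenfunction, for the parameter `lam`, of the Dirichlet problem
`-y'' + q y = lam y` in `]0,1[`, `y(0) = y(1) = 0`: a classical solution which is not
identically zero on `[0,1]`. The values of `y` outside `[0,1]` play no role. -/
structure IsDirichletEigenfunction (q : ℝ → ℝ) (lam : ℝ) (y : ℝ → ℝ) : Prop where
  contDiffOn : ContDiffOn ℝ 2 y (Icc 0 1)
  equation : ∀ x ∈ Ioo (0 : ℝ) 1, -(deriv (deriv y) x) + q x * y x = lam * y x
  left : y 0 = 0
  right : y 1 = 0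
  nontrivial : ∃ x ∈ Icc (0 : ℝ) 1, y x ≠ 0

/-- `lam` is an eigenvalue of the Dirichlet problem. -/
def IsDirichletEigenvalue (q : ℝ → ℝ) (lam : ℝ) : Prop :=
  ∃ y : ℝ → ℝ, IsDirichletEigenfunction q lam y

/-- `lam` is the `k`-th eigenvalue `λ_k` (`k ≥ 1`) in increasing order: it is an eigenvalue, and
exactly `k` eigenvalues are at most `lam`. -/
def IsKthDirichletEigenvalue (q : ℝ → ℝ) (k : ℕ) (lam : ℝ) : Prop :=
  IsDirichletEigenvalue q lam ∧
    {μ : ℝ | IsDirichletEigenvalue q μ ∧ μ ≤ lam}.encard = (k : ℕ∞)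

/-- The multiplicity of `x` as a zero of `f`: the supremum of the `k` such that
`f, f', …, f^(k-1)` all vanish at `x`. It is `0` if `f x ≠ 0`, and `⊤` if all derivatives
vanish. -/
noncomputable def zeroMultiplicity (f : ℝ → ℝ) (x : ℝ) : ℕ∞ :=
  ⨆ (k : ℕ) (_ : ∀ i < k, iteratedDeriv i f x = 0), (k : ℕ∞)

/-- The number of zeros of `f` in `S`, counted with multiplicities (possibly `⊤`): the sum of
the multiplicities over `S`, as the supremum of its finite partial sums. -/
noncomputable def zeroCount (f : ℝ → ℝ) (S : Set ℝ) : ℕ∞ :=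
  ⨆ (s : Finset ℝ) (_ : (s : Set ℝ) ⊆ S), ∑ x ∈ s, zeroMultiplicity f x

/-- `f` changes sign at `z`: it vanishes at `z`, and it has a strict constant sign just to the
left of `z` and the opposite strict sign just to the right of `z`. -/
def ChangesSignAt (f : ℝ → ℝ) (z : ℝ) : Prop :=
  f z = 0 ∧
    (((∀ᶠ x in 𝓝[<] z, f x < 0) ∧ (∀ᶠ x in 𝓝[>] z, 0 < f x)) ∨
      ((∀ᶠ x in 𝓝[<] z, 0 < f x) ∧ (∀ᶠ x in 𝓝[>] z, f x < 0)))

/-! For the upper bound, let `g` be a first eigenfunction, with eigenvalue `mu` and no zero in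
`]0,1[`. If `U'' = (q - mu) U + F`, then `U/g` has derivative `W/g²`, where `W = g U' - g' U`, and
`W' = g F`. Rolle's theorem from `U/g` to `W` loses one zero; from `W` to `W'` it gains one back,
because `W` also vanishes at both endpoints. So `F` has at least as many zeros as `U`
(`zeroCount_le_of_forced`). For `U = ∑ a_k h_k`, up to a constant factor `F` replaces `a_k` by `a_k
(lam_k - mu)/c`. Take `c = lam_N - mu`, with `N` the largest index such that `a_N ≠ 0`. Iterating
never decreases the number of zeros and drives the combination to `a_N h_N` in `C¹`. The zeros of
`h_N` are simple, so combinations close to the limit have no more zeros than `h_N`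
(`exists_zeroCount_le_of_close`). That `h_N` has at most `N - 1` zeros comes from the Prüfer angle
`θ`, given by `y = r sin θ`, `y' = r cos θ`. It crosses multiples of `π` only upwards, so if it ends
at `J π` there are at most `J - 1` interior zeros; and since it depends continuously on the
parameter, the values `π, …, J π` are attained at `J` distinct eigenvalues not above `lam_N`, so `J
≤ N`. For the lower bound, suppose `U` has only `p < m - 1` sign changes. Some nontrivial
combination `V` of the first `p + 1` eigenfunctions vanishes at all of them, and by the upper bound
it has no other zeros and these are simple. Then `U V` keeps one sign, although its integral is zero
by orthogonality (`le_encard_changesSignAt`). -/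

/-! ### First-order form, Prüfer angles and a Grönwall-type uniqueness lemma -/

/-- `y` solves `-y'' + q y = lam y` on `[0,1]` and `d` is its derivative, one-sided at the
endpoints. -/
structure IsSolutionPair (q : ℝ → ℝ) (lam : ℝ) (y d : ℝ → ℝ) : Prop where
  deriv_fst : ∀ x ∈ Icc (0 : ℝ) 1, HasDerivWithinAt y (d x) (Icc 0 1) x
  deriv_snd : ∀ x ∈ Icc (0 : ℝ) 1, HasDerivWithinAt d ((q x - lam) * y x) (Icc 0 1) x

/-- The right-hand side of the Prüfer equation for the angle. -/
noncomputable def pruferField (q : ℝ → ℝ) (lam t s : ℝ) : ℝ :=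
  1 + (lam - q t - 1) * Real.sin s ^ 2

/-- `θ` is a Prüfer angle on `[0,1]` for the parameter `lam`, starting at `0`. -/
structure IsPruferAngle (q : ℝ → ℝ) (lam : ℝ) (θ : ℝ → ℝ) : Prop where
  zero : θ 0 = 0
  deriv : ∀ x ∈ Icc (0 : ℝ) 1, HasDerivWithinAt θ (pruferField q lam x (θ x)) (Icc 0 1) x

theorem HasDerivWithinAt.Ici_of_Icc {f : ℝ → ℝ} {f' a b x : ℝ}
    (h : HasDerivWithinAt f f' (Icc a b) x) (hx : x ∈ Ico a b) :
    HasDerivWithinAt f f' (Ici x) x :=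
  (h.mono (Icc_subset_Icc_left hx.1)).mono_of_mem_nhdsWithin (Icc_mem_nhdsGE hx.2)

theorem HasDerivWithinAt.of_mem_Ioo {f : ℝ → ℝ} {f' a b x : ℝ}
    (h : HasDerivWithinAt f f' (Icc a b) x) (hx : x ∈ Ioo a b) : HasDerivAt f f' x :=
  h.hasDerivAt (Icc_mem_nhds hx.1 hx.2)

/-- A nonnegative function satisfying `|E'| ≤ K E` which vanishes somewhere vanishes
identically. -/
theorem eq_zero_of_abs_deriv_le {E E' : ℝ → ℝ} {K x₀ : ℝ}
    (hE : ∀ x ∈ Icc (0 : ℝ) 1, HasDerivWithinAt E (E' x) (Icc 0 1) x)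
    (h0 : ∀ x ∈ Icc (0 : ℝ) 1, 0 ≤ E x) (hK : ∀ x ∈ Icc (0 : ℝ) 1, |E' x| ≤ K * E x)
    (hx₀ : x₀ ∈ Icc (0 : ℝ) 1) (hz : E x₀ = 0) : ∀ x ∈ Icc (0 : ℝ) 1, E x = 0 := by
  have hc : ContinuousOn E (Icc 0 1) := fun x hx => (hE x hx).continuousWithinAt
  have hexp : ∀ (c x : ℝ), HasDerivAt (fun x => Real.exp (c * x)) (Real.exp (c * x) * c) x := by
    intro c x
    simpa using ((hasDerivAt_id x).const_mul c).exp
  have hder : ∀ (c : ℝ), ∀ x ∈ Ioo (0 : ℝ) 1, HasDerivAt (fun x => Real.exp (c * x) * E x)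
      (Real.exp (c * x) * (c * E x + E' x)) x := by
    intro c x hx
    convert! (hexp c x).mul ((hE x (Ioo_subset_Icc_self hx)).of_mem_Ioo hx) using 1
    ring
  have hcont : ∀ c : ℝ, ContinuousOn (fun x => Real.exp (c * x) * E x) (Icc 0 1) := by
    intro c
    exact ContinuousOn.mul (by fun_prop) hc
  -- The decreasing weight carries the zero at `x₀` to the right; the increasing one below carries
  -- it to the left.
  have hanti : AntitoneOn (fun x => Real.exp (-K * x) * E x) (Icc 0 1) := by
    refine antitoneOn_of_deriv_nonpos (convex_Icc 0 1) (hcont _) ?_ ?_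
    · rw [interior_Icc]
      exact fun x hx => (hder _ x hx).differentiableAt.differentiableWithinAt
    · rw [interior_Icc]
      intro x hx
      rw [(hder _ x hx).deriv]
      have := (abs_le.1 (hK x (Ioo_subset_Icc_self hx))).2
      exact mul_nonpos_of_nonneg_of_nonpos (Real.exp_pos _).le (by linarith)
  have hmono : MonotoneOn (fun x => Real.exp (K * x) * E x) (Icc 0 1) := by
    refine monotoneOn_of_deriv_nonneg (convex_Icc 0 1) (hcont _) ?_ ?_
    · rw [interior_Icc]
      exact fun x hx => (hder _ x hx).differentiableAt.differentiableWithinAt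
    · rw [interior_Icc]
      intro x hx
      rw [(hder _ x hx).deriv]
      have := (abs_le.1 (hK x (Ioo_subset_Icc_self hx))).1
      exact mul_nonneg (Real.exp_pos _).le (by linarith)
  intro x hx
  refine le_antisymm ?_ (h0 x hx)
  rcases le_total x x₀ with hle | hle
  · have := hmono hx hx₀ hle
    simp only [hz, mul_zero] at this
    exact nonpos_of_mul_nonpos_right this (Real.exp_pos _)
  · have := hanti hx₀ hx hle
    simp only [hz, mul_zero] at this
    exact nonpos_of_mul_nonpos_right this (Real.exp_pos _)

theorem exists_primitive_on_Icc {g : ℝ → ℝ} (hg : ContinuousOn g (Icc 0 1)) :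
    ∃ G : ℝ → ℝ, ∀ x ∈ Icc (0 : ℝ) 1, HasDerivWithinAt G (g x) (Icc 0 1) x := by
  have hc : Continuous (IccExtend zero_le_one ((Icc (0 : ℝ) 1).domRestrict g)) :=
    (continuousOn_iff_continuous_domRestrict.1 hg).Icc_extend'
  refine ⟨fun x => ∫ t in (0 : ℝ)..x, IccExtend zero_le_one ((Icc (0 : ℝ) 1).domRestrict g) t,
    fun x hx => ?_⟩
  have := (hc.integral_hasStrictDerivAt 0 x).hasDerivAt.hasDerivWithinAt (s := Icc (0 : ℝ) 1)
  rwa [IccExtend_of_mem _ _ hx] at this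

/-! ### Existence, continuous dependence and monotone crossings of the Prüfer angle -/

theorem abs_sin_sq_sub_sin_sq_le (a b : ℝ) :
    |Real.sin a ^ 2 - Real.sin b ^ 2| ≤ 2 * |a - b| := by
  have h1 : |Real.sin a - Real.sin b| ≤ |a - b| := by
    simpa [Real.dist_eq] using Real.lipschitzWith_sin.dist_le_mul a b
  have h2 : |Real.sin a + Real.sin b| ≤ 2 :=
    (abs_add_le _ _).trans (by linarith [Real.abs_sin_le_one a, Real.abs_sin_le_one b])
  calc |Real.sin a ^ 2 - Real.sin b ^ 2|
      = |Real.sin a + Real.sin b| * |Real.sin a - Real.sin b| := by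
        rw [← abs_mul]; congr 1; ring
    _ ≤ 2 * |a - b| := mul_le_mul h2 h1 (abs_nonneg _) zero_le_two

theorem abs_pruferField_sub_le {q : ℝ → ℝ} {lam C t : ℝ} (hC : |lam - q t - 1| ≤ C) (a b : ℝ) :
    |pruferField q lam t a - pruferField q lam t b| ≤ 2 * C * |a - b| := by
  have h0 : 0 ≤ C := (abs_nonneg _).trans hC
  calc |pruferField q lam t a - pruferField q lam t b|
      = |lam - q t - 1| * |Real.sin a ^ 2 - Real.sin b ^ 2| := by
        rw [← abs_mul]; congr 1; unfold pruferField; ring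
    _ ≤ C * (2 * |a - b|) :=
        mul_le_mul hC (abs_sin_sq_sub_sin_sq_le a b) (abs_nonneg _) h0
    _ = _ := by ring

theorem exists_bound_potential {q : ℝ → ℝ} (hq : ContinuousOn q (Icc 0 1)) (lam : ℝ) :
    ∃ C : ℝ, 0 ≤ C ∧ ∀ t ∈ Icc (0 : ℝ) 1, |lam - q t - 1| ≤ C := by
  obtain ⟨C, hC⟩ := isCompact_Icc.exists_bound_of_continuousOn
    (f := fun t => lam - q t - 1) (by fun_prop : ContinuousOn (fun t => lam - q t - 1) (Icc 0 1))
  exact ⟨C, (norm_nonneg _).trans (hC 0 (by simp)), hC⟩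

theorem exists_isPruferAngle {q : ℝ → ℝ} (hq : ContinuousOn q (Icc 0 1)) (lam : ℝ) :
    ∃ θ, IsPruferAngle q lam θ := by
  obtain ⟨C, hC0, hC⟩ := exists_bound_potential hq lam
  -- The field is bounded by `1 + C` and `2 * C`-Lipschitz for all angles, so a ball of radius `1 +
  -- C` already contains the trajectory over unit time.
  have hL : IsPicardLindelof (pruferField q lam) (tmin := 0) (tmax := 1)
      ⟨0, by simp⟩ 0 (1 + C).toNNReal 0 (1 + C).toNNReal (2 * C).toNNReal := by
    refine ⟨fun t ht => LipschitzOnWith.of_dist_le_mul fun a _ b _ => ?_, fun x _ => ?_,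
      fun t ht x _ => ?_, ?_⟩
    · rw [Real.coe_toNNReal _ (by positivity), Real.dist_eq, Real.dist_eq]
      exact abs_pruferField_sub_le (hC t ht) a b
    · unfold pruferField
      fun_prop
    · rw [Real.coe_toNNReal _ (by positivity), Real.norm_eq_abs]
      refine (abs_add_le _ _).trans ?_
      rw [abs_one, abs_mul, abs_of_nonneg (sq_nonneg (Real.sin x))]
      gcongr
      exact (mul_le_mul (hC t ht) (Real.sin_sq_le_one x) (sq_nonneg _) hC0).trans_eq (mul_one C)
    · simp
  obtain ⟨θ, h0, h⟩ := hL.exists_eq_forall_mem_Icc_hasDerivWithinAt₀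
  exact ⟨θ, h0, h⟩

theorem IsPruferAngle.continuousOn {q θ : ℝ → ℝ} {lam : ℝ} (h : IsPruferAngle q lam θ) :
    ContinuousOn θ (Icc 0 1) := fun x hx => (h.deriv x hx).continuousWithinAt

/-- Grönwall: `φ` solves the equation of `θ` up to an error `|mu - lam| sin² φ ≤ |mu - lam|`. -/
theorem abs_pruferAngle_sub_le {q θ φ : ℝ → ℝ} {lam mu C : ℝ}
    (hθ : IsPruferAngle q lam θ) (hφ : IsPruferAngle q mu φ)
    (hC0 : 0 ≤ C) (hC : ∀ t ∈ Icc (0 : ℝ) 1, |lam - q t - 1| ≤ C) :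
    |φ 1 - θ 1| ≤ gronwallBound 0 (2 * C) |mu - lam| 1 := by
  have key := dist_le_of_approx_trajectories_ODE_of_mem (v := pruferField q lam)
    (K := (2 * C).toNNReal) (s := fun _ => univ) (f := φ) (g := θ) (a := 0) (b := 1)
    (f' := fun t => pruferField q mu t (φ t)) (g' := fun t => pruferField q lam t (θ t))
    (εf := |mu - lam|) (εg := 0) (δ := 0) ?_ hφ.continuousOn ?_ ?_ (fun _ _ => trivial)
    hθ.continuousOn ?_ ?_ (fun _ _ => trivial) ?_ 1 (by simp)
  · simpa [Real.dist_eq, Real.coe_toNNReal _ (mul_nonneg zero_le_two hC0)] using key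
  · refine fun t ht => LipschitzOnWith.of_dist_le_mul fun a _ b _ => ?_
    rw [Real.coe_toNNReal _ (by positivity), Real.dist_eq, Real.dist_eq]
    exact abs_pruferField_sub_le (hC t (Ico_subset_Icc_self ht)) a b
  · exact fun t ht => (hφ.deriv t (Ico_subset_Icc_self ht)).Ici_of_Icc ht
  · intro t _
    rw [Real.dist_eq]
    have : pruferField q mu t (φ t) - pruferField q lam t (φ t)
        = (mu - lam) * Real.sin (φ t) ^ 2 := by unfold pruferField; ring
    rw [this, abs_mul, abs_of_nonneg (sq_nonneg (Real.sin (φ t)))]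
    exact mul_le_of_le_one_right (abs_nonneg _) (Real.sin_sq_le_one _)
  · exact fun t ht => (hθ.deriv t (Ico_subset_Icc_self ht)).Ici_of_Icc ht
  · simp
  · simp [hθ.zero, hφ.zero]

theorem continuous_pruferAngle_one {q : ℝ → ℝ} (hq : ContinuousOn q (Icc 0 1))
    {Θ : ℝ → ℝ → ℝ} (hΘ : ∀ lam, IsPruferAngle q lam (Θ lam)) :
    Continuous fun lam => Θ lam 1 := by
  rw [continuous_iff_continuousAt]
  intro lam
  obtain ⟨C, hC0, hC⟩ := exists_bound_potential hq lam
  rw [ContinuousAt, tendsto_iff_dist_tendsto_zero]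
  refine squeeze_zero (fun _ => dist_nonneg)
    (fun mu => abs_pruferAngle_sub_le (hΘ lam) (hΘ mu) hC0 hC) ?_
  have h : Continuous fun mu : ℝ => gronwallBound 0 (2 * C) |mu - lam| 1 :=
    (gronwallBound_continuous_ε 0 (2 * C) 1).comp (by fun_prop)
  simpa [gronwallBound_ε0_δ0] using h.tendsto lam

/-- The field is then at most `1`. Since `1 < π`, this is the low starting value for the
intermediate value theorem in the parameter. -/
theorem IsPruferAngle.le_one {q θ : ℝ → ℝ} {lam : ℝ} (h : IsPruferAngle q lam θ)
    (hlam : ∀ t ∈ Icc (0 : ℝ) 1, lam - q t - 1 < 0) : θ 1 ≤ 1 := by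
  have hb := image_le_of_deriv_right_le_deriv_boundary (f := θ) (a := 0) (b := 1) (B := id)
    (B' := fun _ => 1) h.continuousOn
    (fun t ht => (h.deriv t (Ico_subset_Icc_self ht)).Ici_of_Icc ht) (by simp [h.zero])
    continuousOn_id (fun t _ => hasDerivWithinAt_id _ _) ?_ (x := 1) (by simp)
  · exact hb
  · intro t ht
    have := hlam t (Ico_subset_Icc_self ht)
    unfold pruferField
    nlinarith [sq_nonneg (Real.sin (θ t))]

/-- A Prüfer angle crosses multiples of `π` upwards only. -/
theorem IsPruferAngle.lt_of_eq_mul_pi {q θ : ℝ → ℝ} {lam : ℝ}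
    (hq : ContinuousOn q (Icc 0 1)) (h : IsPruferAngle q lam θ) {k : ℤ} {x y : ℝ}
    (hx : 0 ≤ x) (hxy : x < y) (hy : y ≤ 1) (hk : θ x = k * Real.pi) : k * Real.pi < θ y := by
  obtain ⟨C, hC0, hC⟩ := exists_bound_potential hq lam
  -- The line of slope `ε` from `(x, k π)` is a lower barrier. Where it meets `θ`, `sin² θ ≤ ε²`, so
  -- the field is at least `1 - C ε²`, which exceeds `ε` for this choice.
  set ε : ℝ := (2 + C)⁻¹ with hε
  have hεpos : 0 < ε := by positivity
  have hε1 : ε * (2 + C) = 1 := inv_mul_cancel₀ (by positivity)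
  have hsub : Icc x y ⊆ Icc (0 : ℝ) 1 := Icc_subset_Icc hx hy
  have hb := image_le_of_deriv_right_lt_deriv_boundary' (a := x) (b := y)
    (f := fun t => k * Real.pi + ε * (t - x)) (f' := fun _ => ε) (B := θ)
    (B' := fun t => pruferField q lam t (θ t)) (by fun_prop) ?_ (by simp [hk])
    (h.continuousOn.mono hsub) ?_ ?_ (x := y) (right_mem_Icc.2 hxy.le)
  · have : 0 < ε * (y - x) := mul_pos hεpos (sub_pos.2 hxy)
    linarith
  · intro t _
    simpa using ((((hasDerivAt_id t).sub_const x).const_mul ε).const_add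
      (k * Real.pi)).hasDerivWithinAt
  · exact fun t ht => ((h.deriv t (hsub (Ico_subset_Icc_self ht))).mono hsub).Ici_of_Icc ht
  · intro t ht heq
    have htx : 0 ≤ t - x := sub_nonneg.2 ht.1
    have htx1 : t - x ≤ 1 := by linarith [ht.2]
    have hs : Real.sin (θ t) ^ 2 = Real.sin (ε * (t - x)) ^ 2 := by
      rw [← heq, add_comm, Real.sin_add_int_mul_pi, mul_pow]
      rcases Int.even_or_odd k with hk | hk <;> simp [hk.neg_one_zpow]
    have hs2 : Real.sin (ε * (t - x)) ^ 2 ≤ ε ^ 2 := by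
      rw [sq_le_sq]
      refine Real.abs_sin_le_abs.trans ?_
      rw [abs_mul]
      exact mul_le_of_le_one_right (abs_nonneg _) (by rw [abs_of_nonneg htx]; exact htx1)
    have h1 := (abs_le.1 (hC t (hsub (Ico_subset_Icc_self ht)))).1
    have hε2 : ε ≤ 1 / 2 := by
      rw [hε, inv_eq_one_div]
      exact one_div_le_one_div_of_le (by norm_num) (by linarith)
    unfold pruferField
    rw [hs]
    have h2 : -C * ε ^ 2 ≤ (lam - q t - 1) * Real.sin (ε * (t - x)) ^ 2 := by
      nlinarith [sq_nonneg (Real.sin (ε * (t - x)))]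
    nlinarith

/-! ### Solutions, their regularity and their Prüfer representation -/

theorem IsSolutionPair.continuousOn_fst {q y d : ℝ → ℝ} {lam : ℝ} (h : IsSolutionPair q lam y d) :
    ContinuousOn y (Icc 0 1) := fun x hx => (h.deriv_fst x hx).continuousWithinAt

theorem IsSolutionPair.continuousOn_snd {q y d : ℝ → ℝ} {lam : ℝ} (h : IsSolutionPair q lam y d) :
    ContinuousOn d (Icc 0 1) := fun x hx => (h.deriv_snd x hx).continuousWithinAt

/-- The energy `y² + d²` has derivative `2 y d (1 + q - lam)`, bounded by a multiple of itself. -/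
theorem IsSolutionPair.eq_zero {q y d : ℝ → ℝ} {lam x₀ : ℝ} (hq : ContinuousOn q (Icc 0 1))
    (h : IsSolutionPair q lam y d) (hx₀ : x₀ ∈ Icc (0 : ℝ) 1) (hy : y x₀ = 0) (hd : d x₀ = 0) :
    ∀ x ∈ Icc (0 : ℝ) 1, y x = 0 := by
  obtain ⟨C, hC0, hC⟩ := exists_bound_potential hq lam
  have := eq_zero_of_abs_deriv_le (E := fun x => y x ^ 2 + d x ^ 2)
    (E' := fun x => 2 * y x * d x + 2 * d x * ((q x - lam) * y x)) (K := C + 2)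
    (fun x hx => by
      simpa using! ((h.deriv_fst x hx).pow 2).add ((h.deriv_snd x hx).pow 2))
    (fun x _ => by positivity) (fun x hx => ?_) hx₀ (by simp [hy, hd])
  · intro x hx
    have h2 := this x hx
    nlinarith [sq_nonneg (y x), sq_nonneg (d x)]
  · have h1 : 2 * y x * d x + 2 * d x * ((q x - lam) * y x)
        = (2 * y x * d x) * (-(lam - q x - 1)) := by ring
    have h2 : |2 * y x * d x| ≤ y x ^ 2 + d x ^ 2 := by
      rw [abs_le]; constructor <;> nlinarith [sq_nonneg (y x + d x), sq_nonneg (y x - d x)]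
    rw [h1, abs_mul, abs_neg]
    calc |2 * y x * d x| * |lam - q x - 1| ≤ (y x ^ 2 + d x ^ 2) * C :=
          mul_le_mul h2 (hC x hx) (abs_nonneg _) (by positivity)
      _ ≤ _ := by nlinarith [sq_nonneg (y x), sq_nonneg (d x)]

/-- The defect `d sin θ - y cos θ` solves a homogeneous linear equation and vanishes at `0`. This
links any solution to the angle without constructing an amplitude for it. -/
theorem IsSolutionPair.prufer_relation {q y d θ : ℝ → ℝ} {lam : ℝ}
    (hq : ContinuousOn q (Icc 0 1)) (h : IsSolutionPair q lam y d) (hy : y 0 = 0)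
    (hθ : IsPruferAngle q lam θ) :
    ∀ x ∈ Icc (0 : ℝ) 1, d x * Real.sin (θ x) = y x * Real.cos (θ x) := by
  obtain ⟨C, hC0, hC⟩ := exists_bound_potential hq lam
  have := eq_zero_of_abs_deriv_le
    (E := fun x => (d x * Real.sin (θ x) - y x * Real.cos (θ x)) ^ 2)
    (E' := fun x => 2 * (lam - q x - 1) * Real.sin (θ x) * Real.cos (θ x) *
      (d x * Real.sin (θ x) - y x * Real.cos (θ x)) ^ 2) (K := 2 * C) (x₀ := 0)
    (fun x hx => ?_) (fun x _ => by positivity) (fun x hx => ?_) (by simp) (by simp [hy, hθ.zero])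
  · intro x hx
    have h2 := this x hx
    exact sub_eq_zero.1 (pow_eq_zero_iff two_ne_zero |>.1 h2)
  · convert! (((h.deriv_snd x hx).mul (hθ.deriv x hx).sin).sub
      ((h.deriv_fst x hx).mul (hθ.deriv x hx).cos)).pow 2 using 1
    simp only [pruferField, Pi.mul_apply, Pi.sub_apply, Nat.cast_ofNat, Nat.add_one_sub_one,
      pow_one]
    have hs := Real.sin_sq_add_cos_sq (θ x)
    have hcs : Real.cos (θ x) ^ 2 = 1 - Real.sin (θ x) ^ 2 := by linarith
    generalize Real.sin (θ x) = s at *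
    generalize Real.cos (θ x) = c at *
    linear_combination (-(2 * (d x * s - y x * c) * (lam - q x - 1) * s * y x)) * hcs
  · have hsc : |2 * Real.sin (θ x) * Real.cos (θ x)| ≤ 2 := by
      rw [abs_mul, abs_mul, abs_two]
      nlinarith [Real.abs_sin_le_one (θ x), Real.abs_cos_le_one (θ x),
        abs_nonneg (Real.sin (θ x)), abs_nonneg (Real.cos (θ x))]
    rw [abs_mul, abs_of_nonneg (sq_nonneg (d x * Real.sin (θ x) - y x * Real.cos (θ x)))]
    refine mul_le_mul_of_nonneg_right ?_ (sq_nonneg _)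
    rw [show 2 * (lam - q x - 1) * Real.sin (θ x) * Real.cos (θ x)
      = (2 * Real.sin (θ x) * Real.cos (θ x)) * (lam - q x - 1) by ring, abs_mul]
    exact mul_le_mul hsc (hC x hx) (abs_nonneg _) zero_le_two

/-- The amplitude `r = exp G` must satisfy `r' = (1 + q - lam) sin θ cos θ r`, so `G` is obtained by
a quadrature. -/
theorem IsPruferAngle.exists_isSolutionPair {q θ : ℝ → ℝ} {lam : ℝ}
    (hq : ContinuousOn q (Icc 0 1)) (hθ : IsPruferAngle q lam θ) :
    ∃ G : ℝ → ℝ, IsSolutionPair q lam (fun x => Real.exp (G x) * Real.sin (θ x))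
      (fun x => Real.exp (G x) * Real.cos (θ x)) := by
  have hθc := hθ.continuousOn
  obtain ⟨G, hG⟩ := exists_primitive_on_Icc
    (g := fun x => (1 + q x - lam) * Real.sin (θ x) * Real.cos (θ x))
    ((((continuousOn_const.add hq).sub continuousOn_const).mul
      (Real.continuous_sin.comp_continuousOn hθc)).mul (Real.continuous_cos.comp_continuousOn hθc))
  refine ⟨G, fun x hx => ?_, fun x hx => ?_⟩
  · convert! (hG x hx).exp.mul (hθ.deriv x hx).sin using 1
    simp only [pruferField]
    ring
  · convert! (hG x hx).exp.mul (hθ.deriv x hx).cos using 1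
    simp only [pruferField]
    have hcs : Real.cos (θ x) ^ 2 = 1 - Real.sin (θ x) ^ 2 := by
      linarith [Real.sin_sq_add_cos_sq (θ x)]
    generalize Real.sin (θ x) = s at *
    generalize Real.cos (θ x) = c at *
    linear_combination (-(Real.exp (G x) * s * (1 + q x - lam))) * hcs

/-- The equation is assumed only in the open interval; continuity of the one-sided second derivative
extends it to the endpoints. -/
theorem IsDirichletEigenfunction.exists_isSolutionPair {q h : ℝ → ℝ} {lam : ℝ}
    (hq : ContinuousOn q (Icc 0 1)) (hh : IsDirichletEigenfunction q lam h) :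
    ∃ d, IsSolutionPair q lam h d := by
  have hu : UniqueDiffOn ℝ (Icc (0 : ℝ) 1) := uniqueDiffOn_Icc_zero_one
  have h2 : ContDiffOn ℝ (1 + 1) h (Icc 0 1) := by
    rw [one_add_one_eq_two]; exact hh.contDiffOn
  obtain ⟨hd, -, h1⟩ := (contDiffOn_succ_iff_derivWithin hu).1 h2
  set d := derivWithin h (Icc 0 1) with hdef
  have hcont : ContinuousOn (derivWithin d (Icc 0 1)) (Icc 0 1) :=
    h1.continuousOn_derivWithin hu le_rfl
  have heq : EqOn (derivWithin d (Icc 0 1)) (fun x => (q x - lam) * h x) (Icc 0 1) := by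
    refine EqOn.of_subset_closure (s := Ioo 0 1) (fun x hx => ?_) hcont
      ((hq.sub continuousOn_const).mul hh.contDiffOn.continuousOn) Ioo_subset_Icc_self
      (by rw [closure_Ioo zero_ne_one])
    have hev : d =ᶠ[𝓝 x] deriv h := by
      filter_upwards [isOpen_Ioo.mem_nhds hx] with y hy
      exact derivWithin_of_mem_nhds (Icc_mem_nhds hy.1 hy.2)
    rw [derivWithin_of_mem_nhds (Icc_mem_nhds hx.1 hx.2), hev.deriv_eq]
    linarith [hh.equation x hx]
  refine ⟨d, fun x hx => (hd x hx).hasDerivWithinAt, fun x hx => ?_⟩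
  have := ((h1.differentiableOn one_ne_zero) x hx).hasDerivWithinAt
  rwa [heq hx] at this

theorem IsSolutionPair.deriv_eq {q y d : ℝ → ℝ} {lam x : ℝ} (h : IsSolutionPair q lam y d)
    (hx : x ∈ Ioo (0 : ℝ) 1) : deriv y x = d x :=
  ((h.deriv_fst x (Ioo_subset_Icc_self hx)).of_mem_Ioo hx).deriv

theorem IsSolutionPair.deriv_deriv_eq {q y d : ℝ → ℝ} {lam x : ℝ} (h : IsSolutionPair q lam y d)
    (hx : x ∈ Ioo (0 : ℝ) 1) : deriv (deriv y) x = (q x - lam) * y x := by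
  have hev : deriv y =ᶠ[𝓝 x] d := by
    filter_upwards [isOpen_Ioo.mem_nhds hx] with z hz using h.deriv_eq hz
  rw [hev.deriv_eq]
  exact ((h.deriv_snd x (Ioo_subset_Icc_self hx)).of_mem_Ioo hx).deriv

theorem IsSolutionPair.isDirichletEigenfunction {q y d : ℝ → ℝ} {lam : ℝ}
    (hq : ContinuousOn q (Icc 0 1)) (h : IsSolutionPair q lam y d) (h0 : y 0 = 0) (h1 : y 1 = 0)
    (hne : ∃ x ∈ Icc (0 : ℝ) 1, y x ≠ 0) : IsDirichletEigenfunction q lam y := by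
  have hu : UniqueDiffOn ℝ (Icc (0 : ℝ) 1) := uniqueDiffOn_Icc_zero_one
  have hd : ContDiffOn ℝ 1 d (Icc 0 1) := by
    rw [show (1 : WithTop ℕ∞) = 0 + 1 by simp, contDiffOn_succ_iff_derivWithin hu]
    refine ⟨fun x hx => (h.deriv_snd x hx).differentiableWithinAt, by simp, ?_⟩
    rw [contDiffOn_zero]
    exact ((hq.sub continuousOn_const).mul h.continuousOn_fst).congr
      fun x hx => (h.deriv_snd x hx).derivWithin (hu x hx)
  refine ⟨?_, fun x hx => ?_, h0, h1, hne⟩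
  · rw [← one_add_one_eq_two, contDiffOn_succ_iff_derivWithin hu]
    exact ⟨fun x hx => (h.deriv_fst x hx).differentiableWithinAt, by simp,
      hd.congr fun x hx => (h.deriv_fst x hx).derivWithin (hu x hx)⟩
  · rw [h.deriv_deriv_eq hx]
    ring

/-- Bootstrap on the first-order system: if `y` and `d` are `C^n`, their derivatives `d` and `(q -
lam) y` are `C^n` too. -/
theorem IsSolutionPair.contDiffOn {q y d : ℝ → ℝ} {lam : ℝ}
    (hq : ContDiffOn ℝ ∞ q (Ioo 0 1)) (h : IsSolutionPair q lam y d) :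
    ContDiffOn ℝ ∞ y (Ioo 0 1) := by
  have key : ∀ n : ℕ, ContDiffOn ℝ n y (Ioo 0 1) ∧ ContDiffOn ℝ n d (Ioo 0 1) := by
    intro n
    induction n with
    | zero =>
      simp only [Nat.cast_zero, contDiffOn_zero]
      exact ⟨h.continuousOn_fst.mono Ioo_subset_Icc_self,
        h.continuousOn_snd.mono Ioo_subset_Icc_self⟩
    | succ n ih =>
      simp only [Nat.cast_add, Nat.cast_one, contDiffOn_succ_iff_deriv_of_isOpen isOpen_Ioo]
      refine ⟨⟨fun x hx => ((h.deriv_fst x (Ioo_subset_Icc_self hx)).mono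
        Ioo_subset_Icc_self).differentiableWithinAt, by simp, ih.2.congr fun x hx => h.deriv_eq hx⟩,
        fun x hx => ((h.deriv_snd x (Ioo_subset_Icc_self hx)).mono
        Ioo_subset_Icc_self).differentiableWithinAt, by simp, ?_⟩
      refine (((hq.of_le (by exact_mod_cast le_top)).sub contDiffOn_const).mul ih.1).congr
        fun x hx => ((h.deriv_snd x (Ioo_subset_Icc_self hx)).of_mem_Ioo hx).deriv
  exact contDiffOn_infty.2 fun n => (key n).1

theorem IsSolutionPair.snd_ne_zero {q h d : ℝ → ℝ} {lam x : ℝ}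
    (hq : ContinuousOn q (Icc 0 1)) (hs : IsSolutionPair q lam h d)
    (hh : IsDirichletEigenfunction q lam h) (hx : x ∈ Icc (0 : ℝ) 1) (hz : h x = 0) : d x ≠ 0 := by
  intro hd
  obtain ⟨y, hy, hne⟩ := hh.nontrivial
  exact hne (hs.eq_zero hq hx hz hd y hy)

theorem IsPruferAngle.isDirichletEigenvalue {q θ : ℝ → ℝ} {lam : ℝ}
    (hq : ContinuousOn q (Icc 0 1)) (hθ : IsPruferAngle q lam θ) (h1 : Real.sin (θ 1) = 0) :
    IsDirichletEigenvalue q lam := by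
  obtain ⟨G, hG⟩ := hθ.exists_isSolutionPair hq
  refine ⟨_, hG.isDirichletEigenfunction hq (by simp [hθ.zero]) (by simp [h1]) ?_⟩
  -- A vanishing solution would have zero derivative at `0`, but that derivative is `exp (G 0) cos 0
  -- > 0`.
  by_contra! hne
  have hd := (hG.deriv_fst 0 (by simp)).congr (f₁ := fun _ => (0 : ℝ))
    (fun x hx => (hne x hx).symm) (hne 0 (by simp)).symm
  have := (uniqueDiffOn_Icc_zero_one 0 (by simp)).eq_deriv _ hd (hasDerivWithinAt_const _ _ _)
  simp [hθ.zero] at this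

/-! ### Zeros of a single eigenfunction, and the ordering of eigenvalues -/

/-- An eigenfunction for the `n`-th eigenvalue has at most `n - 1` zeros in `]0,1[`. -/
theorem IsKthDirichletEigenvalue.encard_zeros_add_one_le {q h : ℝ → ℝ} {lam : ℝ} {n : ℕ}
    (hq : ContinuousOn q (Icc 0 1)) (hlam : IsKthDirichletEigenvalue q n lam)
    (hh : IsDirichletEigenfunction q lam h) :
    {x ∈ Ioo (0 : ℝ) 1 | h x = 0}.encard + 1 ≤ n := by
  choose Θ hΘ using exists_isPruferAngle hq
  obtain ⟨d, hd⟩ := hh.exists_isSolutionPair hq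
  have hsin : ∀ x ∈ Icc (0 : ℝ) 1, h x = 0 → ∃ k : ℤ, Θ lam x = k * Real.pi := by
    intro x hx hz
    have h1 := hd.prufer_relation hq hh.left (hΘ lam) x hx
    rw [hz, zero_mul] at h1
    obtain ⟨k, hk⟩ := Real.sin_eq_zero_iff.1
      ((mul_eq_zero.1 h1).resolve_left (hd.snd_ne_zero hq hh hx hz))
    exact ⟨k, hk.symm⟩
  obtain ⟨J, hJ⟩ := hsin 1 (by simp) hh.right
  have hlt : ∀ {k l : ℤ} {x y : ℝ}, 0 ≤ x → x < y → y ≤ 1 → Θ lam x = k * Real.pi →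
      Θ lam y = l * Real.pi → k < l := by
    intro k l x y hx hxy hy hk hl
    have h1 := (hΘ lam).lt_of_eq_mul_pi hq hx hxy hy hk
    rw [hl] at h1
    exact_mod_cast lt_of_mul_lt_mul_right h1 Real.pi_pos.le
  have h0 : Θ lam 0 = (0 : ℤ) * Real.pi := by simp [(hΘ lam).zero]
  have hJ0 : 0 < J := hlt le_rfl one_pos le_rfl h0 hJ
  choose! k hk using hsin
  -- The multiple of `π` reached at a zero increases strictly from zero to zero, and lies strictly
  -- between `0` and `J`.
  have hzeros : {x ∈ Ioo (0 : ℝ) 1 | h x = 0}.encard ≤ (Ioo 0 J).encard := by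
    refine encard_le_encard_of_injOn (f := k) ?_ ?_
    · rintro x ⟨hx, hz⟩
      have hkx := hk x (Ioo_subset_Icc_self hx) hz
      exact ⟨hlt le_rfl hx.1 hx.2.le h0 hkx, hlt hx.1.le hx.2 le_rfl hkx hJ⟩
    · rintro x ⟨hx, hzx⟩ y ⟨hy, hzy⟩ hxy
      have hkx := hk x (Ioo_subset_Icc_self hx) hzx
      have hky := hk y (Ioo_subset_Icc_self hy) hzy
      rcases lt_trichotomy x y with hl | hl | hl
      · exact absurd hxy (hlt hx.1.le hl hy.2.le hkx hky).ne
      · exact hl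
      · exact absurd hxy (hlt hy.1.le hl hx.2.le hky hkx).ne'
  -- At the parameter `lam - C - 1` the final angle is at most `1 < i π`, and at `lam` it is `J π`.
  -- Distinct `i` give distinct eigenvalues, so monotonicity in the parameter is not needed.
  have hivt : ∀ i ∈ Ioc 0 J, ∃ mu ≤ lam, Θ mu 1 = i * Real.pi := by
    intro i hi
    obtain ⟨C, hC0, hC⟩ := exists_bound_potential hq lam
    have hlow : Θ (lam - C - 1) 1 ≤ 1 := (hΘ _).le_one fun t ht => by
      linarith [(abs_le.1 (hC t ht)).2]
    have hi1 : (1 : ℝ) ≤ i := by exact_mod_cast hi.1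
    have hiJ : (i : ℝ) ≤ J := by exact_mod_cast hi.2
    obtain ⟨mu, hmu, hval⟩ := intermediate_value_Icc (a := lam - C - 1) (b := lam) (by linarith)
      (continuous_pruferAngle_one hq hΘ).continuousOn
      (show (i : ℝ) * Real.pi ∈ _ from ⟨by nlinarith [Real.pi_gt_three], by
        rw [hJ]; exact mul_le_mul_of_nonneg_right hiJ Real.pi_pos.le⟩)
    exact ⟨mu, hmu.2, hval⟩
  choose! M hM hMv using hivt
  have heig : (Ioc 0 J).encard ≤ n := by
    rw [← hlam.2]
    refine encard_le_encard_of_injOn (f := M) (fun i hi => ⟨?_, hM i hi⟩) ?_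
    · exact (hΘ _).isDirichletEigenvalue hq (by rw [hMv i hi, Real.sin_int_mul_pi])
    · intro i hi j hj hij
      have h1 := hMv i hi
      rw [hij, hMv j hj] at h1
      exact_mod_cast (mul_right_cancel₀ Real.pi_ne_zero h1).symm
  refine le_trans ?_ heig
  rw [← Ioo_insert_right hJ0, encard_insert_of_notMem (by simp)]
  gcongr

theorem IsKthDirichletEigenvalue.lt {q : ℝ → ℝ} {lam mu : ℝ} {k l : ℕ}
    (hlam : IsKthDirichletEigenvalue q k lam) (hmu : IsKthDirichletEigenvalue q l mu)
    (hkl : k < l) : lam < mu := by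
  by_contra! hle
  have : (l : ℕ∞) ≤ k := by
    rw [← hlam.2, ← hmu.2]
    exact encard_le_encard fun x hx => ⟨hx.1, hx.2.trans hle⟩
  exact absurd hkl (not_lt.2 (by exact_mod_cast this))

/-- Sorting the `m` eigenvalues up to `lam` produces the lower ones. The main hypotheses start at
index `m`, while the proof needs `λ_1` for comparison and lower eigenfunctions as test functions. -/
theorem IsKthDirichletEigenvalue.exists_lower {q : ℝ → ℝ} {lam : ℝ} {m i : ℕ}
    (hlam : IsKthDirichletEigenvalue q m lam) (hi : 1 ≤ i) (him : i ≤ m) :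
    ∃ mu, IsKthDirichletEigenvalue q i mu := by
  set E := {μ : ℝ | IsDirichletEigenvalue q μ ∧ μ ≤ lam} with hE
  have hfin : E.Finite := finite_of_encard_eq_coe hlam.2
  have hcard : hfin.toFinset.card = m := by
    have := hlam.2
    rw [hfin.encard_eq_coe_toFinset_card] at this
    exact_mod_cast this
  set e := hfin.toFinset.orderEmbOfFin hcard with he
  have hmem : ∀ j, e j ∈ E := fun j => hfin.mem_toFinset.1 (Finset.orderEmbOfFin_mem _ hcard j)
  let i' : Fin m := ⟨i - 1, by omega⟩
  refine ⟨e i', (hmem i').1, ?_⟩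
  have hset : {μ : ℝ | IsDirichletEigenvalue q μ ∧ μ ≤ e i'}
      = ((Finset.Iic i').map e.toEmbedding : Set ℝ) := by
    ext μ
    simp only [mem_ofPred_eq, Finset.coe_map, mem_image, Finset.coe_Iic, mem_Iic]
    constructor
    · rintro ⟨h1, h2⟩
      have hμ : μ ∈ (hfin.toFinset : Set ℝ) := by
        simpa [hE] using ⟨h1, h2.trans (hmem i').2⟩
      rw [← Finset.range_orderEmbOfFin _ hcard] at hμ
      obtain ⟨j, rfl⟩ := hμ
      exact ⟨j, e.le_iff_le.1 h2, rfl⟩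
    · rintro ⟨j, hj, rfl⟩
      exact ⟨(hmem j).1, e.monotone hj⟩
  rw [hset, encard_coe_eq_coe_finsetCard, Finset.card_map, Fin.card_Iic]
  simp only [i', Nat.sub_add_cancel hi]

/-! ### Calculus of multiplicities and zero counts -/

theorem le_zeroMultiplicity {f : ℝ → ℝ} {x : ℝ} {k : ℕ} (h : ∀ i < k, iteratedDeriv i f x = 0) :
    (k : ℕ∞) ≤ zeroMultiplicity f x :=
  le_iSup₂_of_le (f := fun (k : ℕ) (_ : ∀ i < k, iteratedDeriv i f x = 0) => (k : ℕ∞)) k h le_rfl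

theorem zeroMultiplicity_le {f : ℝ → ℝ} {x : ℝ} {N : ℕ∞}
    (h : ∀ k : ℕ, (∀ i < k, iteratedDeriv i f x = 0) → (k : ℕ∞) ≤ N) :
    zeroMultiplicity f x ≤ N := iSup₂_le h

theorem zeroMultiplicity_congr {f g : ℝ → ℝ} {x : ℝ} (h : f =ᶠ[𝓝 x] g) :
    zeroMultiplicity f x = zeroMultiplicity g x := by
  simp only [zeroMultiplicity, fun i => h.iteratedDeriv_eq i]

theorem zeroMultiplicity_eq_zero {f : ℝ → ℝ} {x : ℝ} (h : f x ≠ 0) :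
    zeroMultiplicity f x = 0 := by
  refine le_antisymm (zeroMultiplicity_le fun k hk => ?_) bot_le
  rcases Nat.eq_zero_or_pos k with rfl | hpos
  · simp
  · exact absurd (by simpa using hk 0 hpos) h

theorem one_le_zeroMultiplicity {f : ℝ → ℝ} {x : ℝ} (h : f x = 0) :
    1 ≤ zeroMultiplicity f x := by
  have := le_zeroMultiplicity (f := f) (x := x) (k := 1) (by simpa using h)
  exact_mod_cast this

theorem two_le_zeroMultiplicity {f : ℝ → ℝ} {x : ℝ} (h : f x = 0) (h' : deriv f x = 0) :
    2 ≤ zeroMultiplicity f x := by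
  have := le_zeroMultiplicity (f := f) (x := x) (k := 2) (fun i hi => by
    interval_cases i
    · simpa using h
    · simpa using h')
  exact_mod_cast this

theorem zeroMultiplicity_le_one {f : ℝ → ℝ} {x : ℝ} (h : deriv f x ≠ 0) :
    zeroMultiplicity f x ≤ 1 := by
  refine zeroMultiplicity_le fun k hk => ?_
  by_contra! hlt
  exact h (by simpa using hk 1 (by exact_mod_cast hlt))

theorem zeroMultiplicity_le_deriv_add_one (f : ℝ → ℝ) (x : ℝ) :
    zeroMultiplicity f x ≤ zeroMultiplicity (deriv f) x + 1 := by
  refine zeroMultiplicity_le fun k hk => ?_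
  rcases k with _ | k
  · simp
  · push_cast
    gcongr
    refine le_zeroMultiplicity fun i hi => ?_
    rw [← iteratedDeriv_succ']
    exact hk (i + 1) (by omega)

/-- By Leibniz, every term contains a derivative of `f` of order less than `k`. Where `g` does not
vanish, using `g⁻¹` as well gives the reverse inequality. -/
theorem zeroMultiplicity_le_mul {f g : ℝ → ℝ} {x : ℝ} (hg : ContDiffAt ℝ ∞ g x)
    (hf : ContDiffAt ℝ ∞ f x) : zeroMultiplicity f x ≤ zeroMultiplicity (g * f) x := by
  refine zeroMultiplicity_le fun k hk => le_zeroMultiplicity fun i hi => ?_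
  rw [iteratedDeriv_mul (hg.of_le (by exact_mod_cast le_top))
    (hf.of_le (by exact_mod_cast le_top))]
  refine Finset.sum_eq_zero fun j _ => ?_
  rw [hk (i - j) (by omega), mul_zero]

theorem sum_zeroMultiplicity_le_zeroCount {f : ℝ → ℝ} {S : Set ℝ} {s : Finset ℝ}
    (hs : (s : Set ℝ) ⊆ S) : ∑ x ∈ s, zeroMultiplicity f x ≤ zeroCount f S :=
  le_iSup₂_of_le (f := fun (s : Finset ℝ) (_ : (s : Set ℝ) ⊆ S) => ∑ x ∈ s, zeroMultiplicity f x)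
    s hs le_rfl

theorem zeroCount_le {f : ℝ → ℝ} {S : Set ℝ} {N : ℕ∞}
    (h : ∀ s : Finset ℝ, (∀ x ∈ s, x ∈ S ∧ f x = 0) → ∑ x ∈ s, zeroMultiplicity f x ≤ N) :
    zeroCount f S ≤ N := by
  classical
  refine iSup₂_le fun s hs => ?_
  have := h (s.filter fun x => f x = 0) fun x hx =>
    ⟨hs (Finset.mem_coe.2 (Finset.mem_filter.1 hx).1), (Finset.mem_filter.1 hx).2⟩
  rwa [Finset.sum_filter_of_ne fun x _ hne => not_not.1 (mt zeroMultiplicity_eq_zero hne)] at this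

theorem zeroCount_mono {f g : ℝ → ℝ} {S : Set ℝ}
    (h : ∀ x ∈ S, zeroMultiplicity f x ≤ zeroMultiplicity g x) : zeroCount f S ≤ zeroCount g S :=
  iSup₂_le fun _ hs => (Finset.sum_le_sum fun x hx => h x (hs hx)).trans
    (sum_zeroMultiplicity_le_zeroCount hs)

theorem card_le_sum_zeroMultiplicity {f : ℝ → ℝ} {s : Finset ℝ} (h : ∀ x ∈ s, f x = 0) :
    (s.card : ℕ∞) ≤ ∑ x ∈ s, zeroMultiplicity f x := by
  simpa using Finset.card_nsmul_le_sum s _ 1 fun x hx => one_le_zeroMultiplicity (h x hx)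

theorem encard_zeros_le_zeroCount (f : ℝ → ℝ) (S : Set ℝ) :
    {x ∈ S | f x = 0}.encard ≤ zeroCount f S := by
  by_contra! hlt
  obtain ⟨N, hN⟩ := ENat.ne_top_iff_exists.1 hlt.ne_top
  rw [← hN] at hlt
  obtain ⟨t, ht, htc⟩ := exists_subset_encard_eq (Order.add_one_le_of_lt hlt)
  have hfin : t.Finite := finite_of_encard_le_coe (k := N + 1) (by simp [htc])
  have h1 := (card_le_sum_zeroMultiplicity (f := f) (s := hfin.toFinset)
    fun x hx => (ht (hfin.mem_toFinset.1 hx)).2).trans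
    (sum_zeroMultiplicity_le_zeroCount (S := S) fun x hx =>
      (ht (hfin.mem_toFinset.1 hx)).1)
  rw [← hN, ← hfin.encard_eq_coe_toFinset_card, htc] at h1
  have h2 : N + 1 ≤ N := by exact_mod_cast h1
  omega

/-! ### Rolle's theorem and Sturm's comparison -/

/-- Rolle's theorem with multiplicities on `]0,1[`; the zeros in `e ⊆ {0, 1}` count once. -/
theorem zeroCount_add_card_le_deriv {f : ℝ → ℝ} {e : Finset ℝ}
    (he : (e : Set ℝ) ⊆ {0, 1}) (hf : ContinuousOn f (Ioo 0 1 ∪ e)) (hz : ∀ x ∈ e, f x = 0) :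
    zeroCount f (Ioo 0 1) + e.card ≤ zeroCount (deriv f) (Ioo 0 1) + 1 := by
  classical
  by_cases htop : zeroCount (deriv f) (Ioo 0 1) = ⊤
  · simp [htop]
  have hTfin : {x ∈ Ioo (0 : ℝ) 1 | deriv f x = 0}.Finite :=
    finite_of_encard_le_coe (k := (zeroCount (deriv f) (Ioo 0 1)).toNat) (by
      rw [ENat.natCast_toNat htop]
      exact encard_zeros_le_zeroCount _ _)
  set T := hTfin.toFinset with hT
  have hTmem : ∀ x ∈ T, x ∈ Ioo (0 : ℝ) 1 ∧ deriv f x = 0 := fun x hx => hTfin.mem_toFinset.1 hx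
  have he' : ∀ x ∈ e, x = 0 ∨ x = 1 := fun x hx => by simpa using he hx
  have key : ∀ s : Finset ℝ, (∀ x ∈ s, x ∈ Ioo (0 : ℝ) 1 ∧ f x = 0) →
      ∑ x ∈ s, zeroMultiplicity f x + e.card ≤ zeroCount (deriv f) (Ioo 0 1) + 1 := by
    intro s hs
    have hdisj : Disjoint s e := Finset.disjoint_left.2 fun x hx hxe => by
      have := (hs x hx).1
      rcases he' x hxe with rfl | rfl
      · exact lt_irrefl _ this.1
      · exact lt_irrefl _ this.2
    have hmemU : ∀ x ∈ s ∪ e, x ∈ Icc (0 : ℝ) 1 ∧ x ∈ Ioo (0 : ℝ) 1 ∪ e ∧ f x = 0 := by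
      intro x hx
      rcases Finset.mem_union.1 hx with hx | hx
      · exact ⟨Ioo_subset_Icc_self (hs x hx).1, Or.inl (hs x hx).1, (hs x hx).2⟩
      · exact ⟨by rcases he' x hx with rfl | rfl <;> simp, Or.inr hx, hz x hx⟩
    -- The Rolle points interleave `s ∪ e`, so they are zeros of `deriv f` besides those inherited
    -- from multiple zeros of `f`; they make up for the one unit of multiplicity lost at each point.
    have hcard : (s ∪ e).card ≤ (T \ (s ∪ e)).card + 1 := by
      refine Finset.card_le_sdiff_of_interleaved fun x hx y hy hxy _ => ?_
      obtain ⟨hx1, hx2, hx3⟩ := hmemU x hx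
      obtain ⟨hy1, hy2, hy3⟩ := hmemU y hy
      have hsub : Icc x y ⊆ Ioo 0 1 ∪ e := by
        intro t ht
        rcases ht.1.eq_or_lt with rfl | h1
        · exact hx2
        rcases ht.2.eq_or_lt with rfl | h2
        · exact hy2
        exact Or.inl ⟨hx1.1.trans_lt h1, h2.trans_le hy1.2⟩
      obtain ⟨c, hc, hc0⟩ := exists_deriv_eq_zero hxy (hf.mono hsub) (hx3.trans hy3.symm)
      exact ⟨c, hTfin.mem_toFinset.2 ⟨⟨hx1.1.trans_lt hc.1, hc.2.trans_le hy1.2⟩, hc0⟩, hc⟩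
    have hcard2 : s.card + e.card ≤ (T \ s).card + 1 := by
      rw [← Finset.card_union_of_disjoint hdisj]
      refine hcard.trans (Nat.add_le_add_right (Finset.card_le_card ?_) 1)
      exact Finset.sdiff_subset_sdiff le_rfl Finset.subset_union_left
    calc ∑ x ∈ s, zeroMultiplicity f x + e.card
        ≤ ∑ x ∈ s, (zeroMultiplicity (deriv f) x + 1) + e.card := by
          gcongr with x hx
          exact zeroMultiplicity_le_deriv_add_one f x
      _ = ∑ x ∈ s, zeroMultiplicity (deriv f) x + ((s.card + e.card : ℕ) : ℕ∞) := by
          rw [Finset.sum_add_distrib]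
          simp [add_assoc]
      _ ≤ ∑ x ∈ s, zeroMultiplicity (deriv f) x + (((T \ s).card + 1 : ℕ) : ℕ∞) := by
          gcongr
      _ ≤ ∑ x ∈ s, zeroMultiplicity (deriv f) x +
            (∑ x ∈ T \ s, zeroMultiplicity (deriv f) x + 1) := by
          push_cast
          gcongr
          exact card_le_sum_zeroMultiplicity fun x hx => (hTmem x (Finset.mem_sdiff.1 hx).1).2
      _ = ∑ x ∈ s ∪ T \ s, zeroMultiplicity (deriv f) x + 1 := by
          rw [Finset.sum_union Finset.disjoint_sdiff, add_assoc]
      _ ≤ _ := by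
          gcongr
          refine sum_zeroMultiplicity_le_zeroCount fun x hx => ?_
          rcases Finset.mem_union.1 (Finset.mem_coe.1 hx) with hx | hx
          · exact (hs x hx).1
          · exact (hTmem x (Finset.mem_sdiff.1 hx).1).1
  have h0 : (e.card : ℕ∞) ≤ zeroCount (deriv f) (Ioo 0 1) + 1 := by
    simpa using key ∅ (by simp)
  exact add_le_of_le_tsub_right_of_le h0 (zeroCount_le fun s hs =>
    ENat.le_sub_of_add_le_right (ENat.natCast_ne_top _) (key s hs))

/-- Sturm's comparison of zeros: if `U'' = (q - lam) U + F` and `U(0) = U(1) = 0`, then `F` has at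
least as many zeros as `U`, provided that the equation for `lam` has an eigenfunction without
zeros in `]0,1[`. -/
theorem zeroCount_le_of_forced {q h d U D F : ℝ → ℝ} {lam : ℝ}
    (hq : ContDiffOn ℝ ∞ q (Ioo 0 1)) (hs : IsSolutionPair q lam h d)
    (hne : ∀ x ∈ Ioo (0 : ℝ) 1, h x ≠ 0) (h0 : h 0 = 0) (h1 : h 1 = 0)
    (hU : ∀ x ∈ Icc (0 : ℝ) 1, HasDerivWithinAt U (D x) (Icc 0 1) x)
    (hD : ∀ x ∈ Icc (0 : ℝ) 1, HasDerivWithinAt D ((q x - lam) * U x + F x) (Icc 0 1) x)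
    (hUs : ContDiffOn ℝ ∞ U (Ioo 0 1)) (hFs : ContDiffOn ℝ ∞ F (Ioo 0 1))
    (hU0 : U 0 = 0) (hU1 : U 1 = 0) :
    zeroCount U (Ioo 0 1) ≤ zeroCount F (Ioo 0 1) := by
  have hhs := hs.contDiffOn hq
  have hat : ∀ {g : ℝ → ℝ} {x : ℝ}, ContDiffOn ℝ ∞ g (Ioo 0 1) → x ∈ Ioo (0 : ℝ) 1 →
      ContDiffAt ℝ ∞ g x := fun hg hx => hg.contDiffAt (isOpen_Ioo.mem_nhds hx)
  have hinv : ContDiffOn ℝ ∞ h⁻¹ (Ioo 0 1) := hhs.inv hne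
  set v : ℝ → ℝ := h⁻¹ * U with hv
  have hvs : ContDiffOn ℝ ∞ v (Ioo 0 1) := hinv.mul hUs
  have hdv : ContDiffOn ℝ ∞ (deriv v) (Ioo 0 1) :=
    ((contDiffOn_infty_iff_deriv_of_isOpen isOpen_Ioo).1 hvs).2
  set W : ℝ → ℝ := fun x => h x * D x - d x * U x with hW
  have hWder : ∀ x ∈ Icc (0 : ℝ) 1, HasDerivWithinAt W (h x * F x) (Icc 0 1) x := by
    intro x hx
    convert! ((hs.deriv_fst x hx).mul (hD x hx)).sub ((hs.deriv_snd x hx).mul (hU x hx)) using 1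
    ring
  -- Quotient rule: `(U/h)' = W/h²`.
  have hvder : ∀ x ∈ Ioo (0 : ℝ) 1, (h ^ 2 * deriv v) x = W x := by
    intro x hx
    have hx' := Ioo_subset_Icc_self hx
    have h2 := (((hs.deriv_fst x hx').of_mem_Ioo hx).inv (hne x hx)).mul
      ((hU x hx').of_mem_Ioo hx)
    simp only [Pi.mul_apply, Pi.pow_apply, hv, h2.deriv, hW]
    have := hne x hx
    simp only [Pi.inv_apply]
    field_simp
    ring
  have e1 : zeroCount U (Ioo 0 1) ≤ zeroCount v (Ioo 0 1) :=
    zeroCount_mono fun x hx => zeroMultiplicity_le_mul (hat hinv hx) (hat hUs hx)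
  have e2 : zeroCount v (Ioo 0 1) ≤ zeroCount (deriv v) (Ioo 0 1) + 1 := by
    simpa using zeroCount_add_card_le_deriv (f := v) (e := ∅) (by simp)
      (by simpa using hvs.continuousOn) (by simp)
  have e3 : zeroCount (deriv v) (Ioo 0 1) ≤ zeroCount W (Ioo 0 1) := by
    refine zeroCount_mono fun x hx => ?_
    refine (zeroMultiplicity_le_mul ((hat hhs hx).pow 2) (hat hdv hx)).trans_eq
      (zeroMultiplicity_congr ?_)
    filter_upwards [isOpen_Ioo.mem_nhds hx] with y hy using hvder y hy
  -- Here the boundary conditions enter: `W` is continuous on the closed interval and vanishes at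
  -- both ends, which yields a net gain of one zero. For `v`, undefined as a quotient at the ends,
  -- no endpoint was counted.
  have e4 : zeroCount W (Ioo 0 1) + 2 ≤ zeroCount (deriv W) (Ioo 0 1) + 1 := by
    have := zeroCount_add_card_le_deriv (f := W) (e := {0, 1}) (by simp) ?_ ?_
    · simpa [Finset.card_pair (zero_ne_one (α := ℝ))] using this
    · intro x hx
      have hx' : x ∈ Icc (0 : ℝ) 1 := by
        rcases hx with hx | hx
        · exact Ioo_subset_Icc_self hx
        · have : x = 0 ∨ x = 1 := by simpa using hx
          rcases this with rfl | rfl <;> simp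
      refine (hWder x hx').continuousWithinAt.mono (union_subset Ioo_subset_Icc_self ?_)
      intro y hy
      have : y = 0 ∨ y = 1 := by simpa using hy
      rcases this with rfl | rfl <;> simp
    · intro x hx
      have : x = 0 ∨ x = 1 := by simpa using hx
      rcases this with rfl | rfl <;> simp [hW, h0, h1, hU0, hU1]
  have e5 : zeroCount (deriv W) (Ioo 0 1) ≤ zeroCount F (Ioo 0 1) := by
    refine zeroCount_mono fun x hx => ?_
    have c1 : deriv W =ᶠ[𝓝 x] h * F := by
      filter_upwards [isOpen_Ioo.mem_nhds hx] with y hy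
      exact ((hWder y (Ioo_subset_Icc_self hy)).of_mem_Ioo hy).deriv
    have c2 : h⁻¹ * (h * F) =ᶠ[𝓝 x] F := by
      filter_upwards [isOpen_Ioo.mem_nhds hx] with y hy
      simp [hne y hy]
    rw [zeroMultiplicity_congr c1, ← zeroMultiplicity_congr c2]
    exact zeroMultiplicity_le_mul (hat hinv hx) (hat (hhs.mul hFs) hx)
  have : zeroCount U (Ioo 0 1) + 2 ≤ zeroCount F (Ioo 0 1) + 2 := calc
    zeroCount U (Ioo 0 1) + 2 ≤ zeroCount W (Ioo 0 1) + 1 + 2 := by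
        gcongr; exact e1.trans (e2.trans (by gcongr))
    _ = zeroCount W (Ioo 0 1) + 2 + 1 := by ring
    _ ≤ zeroCount F (Ioo 0 1) + 1 + 1 := add_le_add_left (e4.trans (add_le_add_left e5 1)) 1
    _ = _ := by rw [add_assoc, one_add_one_eq_two]
  exact (ENat.add_le_add_iff_right (by simp)).1 this

/-! ### Stability of simple zeros under `C¹`-small perturbations -/

/-- If all zeros of `f` in `[0,1]` are simple, then every `C¹`-small perturbation of `f` that
vanishes at the endpoints has at most as many zeros in `]0,1[` as `f`. -/
theorem exists_zeroCount_le_of_close {f f' : ℝ → ℝ}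
    (hf : ContinuousOn f (Icc 0 1)) (hf' : ContinuousOn f' (Icc 0 1))
    (hfin : {x ∈ Icc (0 : ℝ) 1 | f x = 0}.Finite)
    (hsimple : ∀ x ∈ Icc (0 : ℝ) 1, f x = 0 → f' x ≠ 0) :
    ∃ ε > 0, ∀ F G : ℝ → ℝ, (∀ x ∈ Icc (0 : ℝ) 1, HasDerivWithinAt F (G x) (Icc 0 1) x) →
      F 0 = 0 → F 1 = 0 → (∀ x ∈ Icc (0 : ℝ) 1, |F x - f x| < ε) →
      (∀ x ∈ Icc (0 : ℝ) 1, |G x - f' x| < ε) →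
      zeroCount F (Ioo 0 1) ≤ {x ∈ Ioo (0 : ℝ) 1 | f x = 0}.encard := by
  set Z := {x ∈ Icc (0 : ℝ) 1 | f x = 0} with hZ
  -- One `δ` is both the radius of the neighbourhoods of the zeros and a lower bound for `|f'|`
  -- there; `ε` below bounds `|f|` away from them, by compactness.
  obtain ⟨δ, hδ0, hδ⟩ : ∃ δ > 0, ∀ z ∈ Z, ∀ x ∈ Icc (0 : ℝ) 1, |x - z| < δ → δ ≤ |f' x| := by
    have hev : ∀ᶠ δ in 𝓝[>] (0 : ℝ), ∀ z ∈ Z, ∀ x ∈ Icc (0 : ℝ) 1, |x - z| < δ → δ ≤ |f' x| := by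
      refine (eventually_all_finite hfin).2 fun z hz => ?_
      have hpos : 0 < |f' z| := abs_pos.2 (hsimple z hz.1 hz.2)
      have hlt := (hf' z hz.1).abs.eventually (lt_mem_nhds (half_lt_self hpos))
      obtain ⟨η, hη, hball⟩ := Metric.mem_nhdsWithin_iff.1 hlt
      filter_upwards [Ioo_mem_nhdsGT (lt_min hη (half_pos hpos))] with δ hδ x hx hxz
      have hx2 : |f' z| / 2 < |f' x| := hball ⟨by
        rw [Metric.mem_ball, Real.dist_eq]
        exact hxz.trans (hδ.2.trans_le (min_le_left _ _)), hx⟩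
      exact (hδ.2.trans_le (min_le_right _ _)).le.trans hx2.le
    obtain ⟨δ, h, hpos⟩ := (hev.and self_mem_nhdsWithin).exists
    exact ⟨δ, hpos, h⟩
  obtain ⟨ε, hε0, hε⟩ : ∃ ε > 0, ∀ x ∈ Icc (0 : ℝ) 1, (∀ z ∈ Z, δ ≤ |x - z|) → ε ≤ |f x| := by
    have hcl : IsClosed {x : ℝ | ∀ z ∈ Z, δ ≤ |x - z|} := by
      simp only [ofPred_forall]
      exact isClosed_biInter fun z _ => isClosed_le continuous_const (by fun_prop)
    obtain ⟨ε, h1, h2⟩ := (isCompact_Icc.inter_right hcl).exists_forall_le' (f := fun x => |f x|)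
      (hf.mono inter_subset_left).abs (a := 0) (fun x hx => abs_pos.2 fun hfx => by
        have := hx.2 x ⟨hx.1, hfx⟩
        simp only [sub_self, abs_zero] at this
        linarith)
    exact ⟨ε, h1, fun x hx hz => h2 x ⟨hx, hz⟩⟩
  refine ⟨min δ ε, lt_min hδ0 hε0, fun F G hF hF0 hF1 hFf hGf => ?_⟩
  have hG : ∀ z ∈ Z, ∀ x ∈ Icc (0 : ℝ) 1, |x - z| < δ → G x ≠ 0 := by
    intro z hz x hx hxz hGx
    have h3 := hGf x hx
    rw [hGx, zero_sub, abs_neg] at h3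
    exact absurd (hδ z hz x hx hxz) (not_le.2 (h3.trans_le (min_le_left _ _)))
  have hnear : ∀ x ∈ Icc (0 : ℝ) 1, F x = 0 → ∃ z ∈ Z, |x - z| < δ := by
    intro x hx hFx
    by_contra! hfar
    have h3 := hFf x hx
    rw [hFx, zero_sub, abs_neg] at h3
    exact absurd (hε x hx hfar) (not_le.2 (h3.trans_le (min_le_right _ _)))
  -- Two zeros of `F` near the same `z` would force, by Rolle, a zero of `G` near `z`.
  have hord : ∀ z ∈ Z, ∀ x ∈ Icc (0 : ℝ) 1, ∀ y ∈ Icc (0 : ℝ) 1, |x - z| < δ → |y - z| < δ →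
      F x = 0 → F y = 0 → ¬ x < y := by
    intro z hz x hx y hy hxz hyz hFx hFy hxy
    have hsub : Icc x y ⊆ Icc (0 : ℝ) 1 := Icc_subset_Icc hx.1 hy.2
    obtain ⟨c, hc, hc0⟩ := exists_hasDerivAt_eq_zero (f := F) (f' := G) hxy
      (fun t ht => ((hF t (hsub ht)).continuousWithinAt).mono hsub) (hFx.trans hFy.symm)
      (fun t ht => ((hF t (hsub (Ioo_subset_Icc_self ht))).of_mem_Ioo
        ⟨hx.1.trans_lt ht.1, ht.2.trans_le hy.2⟩))
    refine hG z hz c (hsub (Ioo_subset_Icc_self hc)) ?_ hc0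
    rw [abs_lt] at *
    constructor <;> linarith [hc.1, hc.2, hxz.1, hyz.2]
  have huniq : ∀ z ∈ Z, ∀ x ∈ Icc (0 : ℝ) 1, ∀ y ∈ Icc (0 : ℝ) 1, |x - z| < δ → |y - z| < δ →
      F x = 0 → F y = 0 → x = y := by
    intro z hz x hx y hy hxz hyz hFx hFy
    exact le_antisymm (not_lt.1 (hord z hz y hy x hx hyz hxz hFy hFx))
      (not_lt.1 (hord z hz x hx y hy hxz hyz hFx hFy))
  choose! φ hφZ hφ using hnear
  refine zeroCount_le fun s hs => ?_
  have hs' : ∀ x ∈ s, x ∈ Icc (0 : ℝ) 1 := fun x hx => Ioo_subset_Icc_self (hs x hx).1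
  calc ∑ x ∈ s, zeroMultiplicity F x ≤ ∑ x ∈ s, 1 := by
        refine Finset.sum_le_sum fun x hx => zeroMultiplicity_le_one ?_
        rw [((hF x (hs' x hx)).of_mem_Ioo (hs x hx).1).deriv]
        exact hG _ (hφZ x (hs' x hx) (hs x hx).2) x (hs' x hx) (hφ x (hs' x hx) (hs x hx).2)
    _ = (s : Set ℝ).encard := by simp
    _ ≤ _ := by
        refine encard_le_encard_of_injOn (f := φ) (fun x hx => ?_) (fun x hx y hy hxy => ?_)
        · have hx1 := hs x hx
          have hx2 := hs' x hx
          have hz := hφZ x hx2 hx1.2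
          have hd := hφ x hx2 hx1.2
          -- The nearby zero `z` of `f` is not an endpoint: `F` vanishes there itself, so by
          -- uniqueness `x` would be that endpoint.
          refine ⟨⟨lt_of_le_of_ne hz.1.1 fun heq => ?_, lt_of_le_of_ne hz.1.2 fun heq => ?_⟩, hz.2⟩
          · exact hx1.1.1.ne' (huniq _ hz x hx2 0 (by simp) hd (by simpa [← heq] using hδ0) hx1.2 hF0)
          · exact hx1.1.2.ne (huniq _ hz x hx2 1 (by simp) hd (by simpa [heq] using hδ0) hx1.2 hF1)
        · have hx1 := hs x hx
          have hx2 := hs' x hx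
          have hy1 := hs y hy
          have hy2 := hs' y hy
          exact huniq _ (hφZ x hx2 hx1.2) x hx2 y hy2 (hφ x hx2 hx1.2)
            (by rw [hxy]; exact hφ y hy2 hy1.2) hx1.2 hy1.2

/-! ### The upper bound for linear combinations -/

theorem IsKthDirichletEigenvalue.lt_of_lt {q : ℝ → ℝ} {lam mu : ℝ} {k l : ℕ}
    (hlam : IsKthDirichletEigenvalue q k lam) (hmu : IsKthDirichletEigenvalue q l mu)
    (h : mu < lam) : l < k := by
  have hsub : {x | IsDirichletEigenvalue q x ∧ x ≤ mu} ⊂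
      {x | IsDirichletEigenvalue q x ∧ x ≤ lam} :=
    ⟨fun x hx => ⟨hx.1, hx.2.trans h.le⟩, fun hs => not_le.2 h (hs ⟨hlam.1, le_rfl⟩).2⟩
  have := (finite_of_encard_eq_coe hmu.2).encard_lt_encard hsub
  rw [hlam.2, hmu.2] at this
  exact_mod_cast this

theorem contDiffOn_linearCombination {q : ℝ → ℝ} {lam : ℕ → ℝ} {h d : ℕ → ℝ → ℝ} {s : Finset ℕ}
    (hq : ContDiffOn ℝ ∞ q (Ioo 0 1)) (hs : ∀ k ∈ s, IsSolutionPair q (lam k) (h k) (d k))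
    (a : ℕ → ℝ) : ContDiffOn ℝ ∞ (fun x => ∑ k ∈ s, a k * h k x) (Ioo 0 1) :=
  ContDiffOn.sum fun k hk => contDiffOn_const.mul ((hs k hk).contDiffOn hq)

theorem hasDerivWithinAt_linearCombination {q : ℝ → ℝ} {lam : ℕ → ℝ} {h d : ℕ → ℝ → ℝ}
    {s : Finset ℕ} (hs : ∀ k ∈ s, IsSolutionPair q (lam k) (h k) (d k)) (a : ℕ → ℝ) {x : ℝ}
    (hx : x ∈ Icc (0 : ℝ) 1) :
    HasDerivWithinAt (fun x => ∑ k ∈ s, a k * h k x) (∑ k ∈ s, a k * d k x) (Icc 0 1) x :=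
  HasDerivWithinAt.fun_sum fun k hk => ((hs k hk).deriv_fst x hx).const_mul (a k)

/-- Sturm's comparison with forcing term `∑ a_k (mu - lam_k) h_k`; the factor `-c⁻¹` keeps its
zeros, and normalizes the iteration. -/
theorem zeroCount_linearCombination_le {q g e : ℝ → ℝ} {mu : ℝ} {lam : ℕ → ℝ}
    {h d : ℕ → ℝ → ℝ} {s : Finset ℕ} (hq : ContDiffOn ℝ ∞ q (Ioo 0 1))
    (hg : IsSolutionPair q mu g e) (hne : ∀ x ∈ Ioo (0 : ℝ) 1, g x ≠ 0) (hg0 : g 0 = 0)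
    (hg1 : g 1 = 0) (hs : ∀ k ∈ s, IsSolutionPair q (lam k) (h k) (d k))
    (h0 : ∀ k ∈ s, h k 0 = 0) (h1 : ∀ k ∈ s, h k 1 = 0) {c : ℝ} (hc : c ≠ 0) (a : ℕ → ℝ) :
    zeroCount (fun x => ∑ k ∈ s, a k * h k x) (Ioo 0 1) ≤
      zeroCount (fun x => ∑ k ∈ s, a k * ((lam k - mu) / c) * h k x) (Ioo 0 1) := by
  have hF := contDiffOn_linearCombination hq hs fun k => a k * (mu - lam k)
  refine (zeroCount_le_of_forced (D := fun x => ∑ k ∈ s, a k * d k x)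
    (F := fun x => ∑ k ∈ s, a k * (mu - lam k) * h k x) hq hg hne hg0 hg1
    (fun x hx => hasDerivWithinAt_linearCombination hs a hx) (fun x hx => ?_)
    (contDiffOn_linearCombination hq hs a) hF
    (Finset.sum_eq_zero fun k hk => by rw [h0 k hk, mul_zero])
    (Finset.sum_eq_zero fun k hk => by rw [h1 k hk, mul_zero])).trans ?_
  · convert! HasDerivWithinAt.fun_sum
      (fun k hk => ((hs k hk).deriv_snd x hx).const_mul (a k)) using 1
    rw [Finset.mul_sum, ← Finset.sum_add_distrib]
    exact Finset.sum_congr rfl fun k _ => by ring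
  · refine zeroCount_mono fun x hx => ?_
    refine (zeroMultiplicity_le_mul (g := fun _ => -c⁻¹) contDiffAt_const
      (hF.contDiffAt (isOpen_Ioo.mem_nhds hx))).trans_eq ?_
    congr 1
    ext y
    simp only [Pi.mul_apply, Finset.mul_sum]
    exact Finset.sum_congr rfl fun k _ => by field_simp; ring

theorem zeroCount_linearCombination_le_pow {q g e : ℝ → ℝ} {mu : ℝ} {lam : ℕ → ℝ}
    {h d : ℕ → ℝ → ℝ} {s : Finset ℕ} (hq : ContDiffOn ℝ ∞ q (Ioo 0 1))
    (hg : IsSolutionPair q mu g e) (hne : ∀ x ∈ Ioo (0 : ℝ) 1, g x ≠ 0) (hg0 : g 0 = 0)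
    (hg1 : g 1 = 0) (hs : ∀ k ∈ s, IsSolutionPair q (lam k) (h k) (d k))
    (h0 : ∀ k ∈ s, h k 0 = 0) (h1 : ∀ k ∈ s, h k 1 = 0) {c : ℝ} (hc : c ≠ 0) (a : ℕ → ℝ) (r : ℕ) :
    zeroCount (fun x => ∑ k ∈ s, a k * h k x) (Ioo 0 1) ≤
      zeroCount (fun x => ∑ k ∈ s, a k * ((lam k - mu) / c) ^ r * h k x) (Ioo 0 1) := by
  induction r with
  | zero => simp
  | succ r ih =>
    refine ih.trans ((zeroCount_linearCombination_le hq hg hne hg0 hg1 hs h0 h1 hc _).trans_eq ?_)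
    simp only [pow_succ, mul_assoc]

theorem exists_pow_sum_lt {s : Finset ℕ} {a c : ℕ → ℝ} (hc : ∀ k ∈ s, 0 ≤ c k ∧ c k < 1)
    (B : ℝ) {ε : ℝ} (hε : 0 < ε) : ∃ r : ℕ, ∑ k ∈ s, |a k| * c k ^ r * B < ε := by
  have : Tendsto (fun r : ℕ => ∑ k ∈ s, |a k| * c k ^ r * B) atTop (𝓝 0) := by
    have h := tendsto_finsetSum (f := fun k (r : ℕ) => |a k| * c k ^ r * B)
      (a := fun _ => (0 : ℝ)) (x := atTop) s fun k hk => by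
        simpa using ((tendsto_pow_atTop_nhds_zero_of_lt_one (hc k hk).1 (hc k hk).2).const_mul
          |a k|).mul_const B
    simpa using h
  exact (this.eventually (gt_mem_nhds hε)).exists

theorem exists_common_bound {s : Finset ℕ} {h : ℕ → ℝ → ℝ}
    (hc : ∀ k ∈ s, ContinuousOn (h k) (Icc 0 1)) :
    ∃ B, ∀ k ∈ s, ∀ x ∈ Icc (0 : ℝ) 1, |h k x| ≤ B := by
  obtain ⟨B, hB⟩ := isCompact_Icc.exists_bound_of_continuousOn
    (f := fun x => ∑ k ∈ s, |h k x|) (continuousOn_finsetSum s fun k hk => (hc k hk).abs)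
  refine ⟨B, fun k hk x hx => ?_⟩
  exact (Finset.single_le_sum (f := fun k => |h k x|) (fun _ _ => abs_nonneg _) hk).trans
    ((le_abs_self _).trans (hB x hx))

theorem abs_linearCombination_sub_le {s : Finset ℕ} {N : ℕ} (hN : N ∈ s) {b : ℕ → ℝ}
    {h : ℕ → ℝ → ℝ} {B x : ℝ} (hB : ∀ k ∈ s, |h k x| ≤ B) :
    |∑ k ∈ s, b k * h k x - b N * h N x| ≤ ∑ k ∈ s.erase N, |b k| * B := by
  rw [← Finset.add_sum_erase s _ hN, add_sub_cancel_left]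
  refine (Finset.abs_sum_le_sum_abs _ _).trans (Finset.sum_le_sum fun k hk => ?_)
  rw [abs_mul]
  exact mul_le_mul_of_nonneg_left (hB k (Finset.mem_of_mem_erase hk)) (abs_nonneg _)

/-- A nontrivial linear combination of eigenfunctions for eigenvalues of index at most `n` has at
most `n - 1` zeros in `]0,1[`, counted with multiplicities. -/
theorem zeroCount_linearCombination_add_one_le {q : ℝ → ℝ} {lam : ℕ → ℝ} {h : ℕ → ℝ → ℝ}
    {s : Finset ℕ} {n : ℕ} (hqc : ContinuousOn q (Icc 0 1)) (hq : ContDiffOn ℝ ∞ q (Ioo 0 1))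
    (hs1 : ∀ k ∈ s, 1 ≤ k) (hsn : ∀ k ∈ s, k ≤ n)
    (hlam : ∀ k ∈ s, IsKthDirichletEigenvalue q k (lam k))
    (hh : ∀ k ∈ s, IsDirichletEigenfunction q (lam k) (h k)) (a : ℕ → ℝ)
    (ha : ∃ k ∈ s, a k ≠ 0) :
    zeroCount (fun x => ∑ k ∈ s, a k * h k x) (Ioo 0 1) + 1 ≤ n := by
  classical
  have hsupp : ∀ x, ∑ k ∈ s, a k * h k x = ∑ k ∈ s.filter (fun k => a k ≠ 0), a k * h k x :=
    fun x => (Finset.sum_filter_of_ne fun k _ hk => left_ne_zero_of_mul hk).symm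
  simp only [hsupp]
  set t := s.filter (fun k => a k ≠ 0) with ht
  have hts : ∀ k ∈ t, k ∈ s := fun k hk => (Finset.mem_filter.1 hk).1
  have htne : t.Nonempty := by
    obtain ⟨k, hk, hak⟩ := ha
    exact ⟨k, Finset.mem_filter.2 ⟨hk, hak⟩⟩
  set N := t.max' htne with hNdef
  have hN : N ∈ t := t.max'_mem htne
  have hle : ∀ k ∈ t, k ≤ N := fun k hk => t.le_max' k hk
  have haN : a N ≠ 0 := (Finset.mem_filter.1 hN).2
  have hex : ∀ k ∈ t, ∃ d, IsSolutionPair q (lam k) (h k) d :=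
    fun k hk => (hh k (hts k hk)).exists_isSolutionPair hqc
  choose! d hd using hex
  have hh0 : ∀ k ∈ t, h k 0 = 0 := fun k hk => (hh k (hts k hk)).left
  have hh1 : ∀ k ∈ t, h k 1 = 0 := fun k hk => (hh k (hts k hk)).right
  have hzN := (hlam N (hts N hN)).encard_zeros_add_one_le hqc (hh N (hts N hN))
  have hzeq : {x ∈ Ioo (0 : ℝ) 1 | a N * h N x = 0} = {x ∈ Ioo (0 : ℝ) 1 | h N x = 0} := by
    simp [haN]
  have hfin : {x ∈ Icc (0 : ℝ) 1 | a N * h N x = 0}.Finite := by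
    have h1 : {x ∈ Ioo (0 : ℝ) 1 | h N x = 0}.Finite :=
      finite_of_encard_le_coe (k := N) (le_self_add.trans hzN)
    refine (h1.union (toFinite {0, 1})).subset fun x hx => ?_
    by_cases h2 : x ∈ Ioo (0 : ℝ) 1
    · exact Or.inl ⟨h2, (mul_eq_zero.1 hx.2).resolve_left haN⟩
    · right
      rcases hx.1.1.eq_or_lt with h3 | h3
      · simp [← h3]
      · rcases hx.1.2.eq_or_lt with h4 | h4
        · simp [h4]
        · exact absurd ⟨h3, h4⟩ h2
  obtain ⟨ε, hε, hclose⟩ := exists_zeroCount_le_of_close (f := fun x => a N * h N x)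
    (f' := fun x => a N * d N x) (continuousOn_const.mul (hd N hN).continuousOn_fst)
    (continuousOn_const.mul (hd N hN).continuousOn_snd) hfin
    (fun x hx hz => mul_ne_zero haN ((hd N hN).snd_ne_zero hqc (hh N (hts N hN)) hx
      ((mul_eq_zero.1 hz).resolve_left haN)))
  rw [hzeq] at hclose
  suffices hb : ∃ b : ℕ → ℝ, b N = a N ∧ zeroCount (fun x => ∑ k ∈ t, a k * h k x) (Ioo 0 1) ≤
      zeroCount (fun x => ∑ k ∈ t, b k * h k x) (Ioo 0 1) ∧
      (∀ x ∈ Icc (0 : ℝ) 1, |∑ k ∈ t, b k * h k x - b N * h N x| < ε) ∧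
      (∀ x ∈ Icc (0 : ℝ) 1, |∑ k ∈ t, b k * d k x - b N * d N x| < ε) by
    obtain ⟨b, hbN, hb1, hb2, hb3⟩ := hb
    rw [hbN] at hb2 hb3
    have := hb1.trans (hclose _ _ (fun x hx => hasDerivWithinAt_linearCombination hd b hx)
      (Finset.sum_eq_zero fun k hk => by rw [hh0 k hk, mul_zero])
      (Finset.sum_eq_zero fun k hk => by rw [hh1 k hk, mul_zero]) hb2 hb3)
    calc _ ≤ {x ∈ Ioo (0 : ℝ) 1 | h N x = 0}.encard + 1 := by gcongr
      _ ≤ N := hzN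
      _ ≤ n := by exact_mod_cast hsn N (hts N hN)
  -- If `N = 1` the normalizing constant `lam N - mu` would be zero, but then only one term is
  -- present and nothing has to be iterated.
  rcases (hs1 N (hts N hN)).eq_or_lt with hN1 | hN1
  · have htN : t = {N} := Finset.eq_singleton_iff_unique_mem.2
      ⟨hN, fun k hk => le_antisymm (hle k hk) (hN1 ▸ hs1 k (hts k hk))⟩
    refine ⟨a, rfl, le_rfl, fun x _ => ?_, fun x _ => ?_⟩ <;> simpa [htN] using hε
  · obtain ⟨mu, hmu⟩ := (hlam N (hts N hN)).exists_lower le_rfl hN1.le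
    obtain ⟨g, hg⟩ := hmu.1
    obtain ⟨e, he⟩ := hg.exists_isSolutionPair hqc
    have hgne : ∀ x ∈ Ioo (0 : ℝ) 1, g x ≠ 0 := by
      intro x hx hgx
      have h1 := hmu.encard_zeros_add_one_le hqc hg
      have h2 : {x ∈ Ioo (0 : ℝ) 1 | g x = 0}.encard = 0 := by
        have h3 : {x ∈ Ioo (0 : ℝ) 1 | g x = 0}.encard + 1 ≤ 0 + 1 := by simpa using h1
        exact le_antisymm ((ENat.add_le_add_iff_right (by simp)).1 h3) bot_le
      exact (encard_eq_zero.1 h2).subset (⟨hx, hgx⟩ : x ∈ {x ∈ Ioo (0 : ℝ) 1 | g x = 0})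
    have hc : 0 < lam N - mu := sub_pos.2 (hmu.lt (hlam N (hts N hN)) hN1)
    -- The ratios lie in `[0,1)` because `mu` is the lowest eigenvalue and `lam N` the largest one
    -- present; their powers tend to `0`, while the ratio for `N` is `1`.
    have hck : ∀ k ∈ t.erase N, 0 ≤ (lam k - mu) / (lam N - mu) ∧
        (lam k - mu) / (lam N - mu) < 1 := by
      intro k hk
      have hkt := Finset.mem_of_mem_erase hk
      have hkN : k < N := lt_of_le_of_ne (hle k hkt) (Finset.ne_of_mem_erase hk)
      refine ⟨div_nonneg (sub_nonneg.2 ?_) hc.le, (div_lt_one hc).2 ?_⟩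
      · by_contra! hlt
        have := hmu.lt_of_lt (hlam k (hts k hkt)) hlt
        have := hs1 k (hts k hkt)
        omega
      · linarith [(hlam k (hts k hkt)).lt (hlam N (hts N hN)) hkN]
    obtain ⟨B₁, hB₁⟩ := exists_common_bound fun k hk => (hd k hk).continuousOn_fst
    obtain ⟨B₂, hB₂⟩ := exists_common_bound fun k hk => (hd k hk).continuousOn_snd
    obtain ⟨r, hr⟩ := exists_pow_sum_lt (a := a) hck (max B₁ B₂) hε
    have hr' : ∑ k ∈ t.erase N, |a k * ((lam k - mu) / (lam N - mu)) ^ r| * max B₁ B₂ < ε := by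
      refine lt_of_eq_of_lt (Finset.sum_congr rfl fun k hk => ?_) hr
      rw [abs_mul, abs_of_nonneg (pow_nonneg (hck k hk).1 r)]
    refine ⟨fun k => a k * ((lam k - mu) / (lam N - mu)) ^ r, by simp [div_self hc.ne'],
      zeroCount_linearCombination_le_pow hq he hgne hg.left hg.right hd hh0 hh1 hc.ne' a r,
      fun x hx => ?_, fun x hx => ?_⟩
    · exact (abs_linearCombination_sub_le hN fun k hk =>
        (hB₁ k hk x hx).trans (le_max_left _ _)).trans_lt hr'
    · exact (abs_linearCombination_sub_le hN fun k hk =>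
        (hB₂ k hk x hx).trans (le_max_right _ _)).trans_lt hr'

/-! ### Orthogonality and test functions -/

/-- The Wronskian-type expression `y e - d z` has derivative `(lam - mu) y z` and vanishes at both
endpoints. -/
theorem integral_mul_eigenfunctions_eq_zero {q y d z e : ℝ → ℝ} {lam mu : ℝ}
    (hy : IsSolutionPair q lam y d) (hz : IsSolutionPair q mu z e) (hne : lam ≠ mu)
    (hy0 : y 0 = 0) (hy1 : y 1 = 0) (hz0 : z 0 = 0) (hz1 : z 1 = 0) :
    ∫ x in (0 : ℝ)..1, y x * z x = 0 := by
  have hcont : ContinuousOn (fun x => (lam - mu) * (y x * z x)) (Icc 0 1) :=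
    continuousOn_const.mul (hy.continuousOn_fst.mul hz.continuousOn_fst)
  have h := intervalIntegral.integral_eq_sub_of_hasDerivAt_of_le (a := 0) (b := 1)
    (f := fun x => y x * e x - d x * z x) (f' := fun x => (lam - mu) * (y x * z x)) zero_le_one
    ((hy.continuousOn_fst.mul hz.continuousOn_snd).sub
      (hy.continuousOn_snd.mul hz.continuousOn_fst)) (fun x hx => ?_)
    (hcont.intervalIntegrable_of_Icc zero_le_one)
  · simp only [hy0, hy1, hz0, hz1, zero_mul, mul_zero, sub_self,
      intervalIntegral.integral_const_mul] at h
    exact (mul_eq_zero.1 h).resolve_left (sub_ne_zero.2 hne)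
  · have hx' := Ioo_subset_Icc_self hx
    convert! (((hy.deriv_fst x hx').mul (hz.deriv_snd x hx')).sub
      ((hy.deriv_snd x hx').mul (hz.deriv_fst x hx'))).of_mem_Ioo hx using 1
    ring

/-- A homogeneous linear system with more unknowns than equations has a nonzero solution. -/
theorem exists_linearCombination_vanishing (s : Finset ℕ) (S : Finset ℝ) (hcard : S.card < s.card)
    (g : ℕ → ℝ → ℝ) :
    ∃ b : ℕ → ℝ, (∃ k ∈ s, b k ≠ 0) ∧ ∀ x ∈ S, ∑ k ∈ s, b k * g k x = 0 := by
  classical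
  let L : (s → ℝ) →ₗ[ℝ] (S → ℝ) := Matrix.mulVecLin (Matrix.of fun (x : S) (k : s) => g k x)
  have hker : LinearMap.ker L ≠ ⊥ := LinearMap.ker_ne_bot_of_finrank_lt (by simpa using hcard)
  obtain ⟨v, hv, hv0⟩ := (Submodule.ne_bot_iff _).1 hker
  obtain ⟨i, hi⟩ := Function.ne_iff.1 hv0
  refine ⟨fun k => if hk : k ∈ s then v ⟨k, hk⟩ else 0, ⟨i, i.2, by simpa using hi⟩, fun x hx => ?_⟩
  have h1 : L v ⟨x, hx⟩ = 0 := by rw [LinearMap.mem_ker.1 hv]; rfl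
  rw [← Finset.sum_coe_sort s]
  simp only [L, Matrix.mulVecLin_apply, Matrix.mulVec, dotProduct, Matrix.of_apply] at h1
  rw [← h1]
  exact Finset.sum_congr rfl fun k _ => by simp [mul_comm]

/-! ### Local signs on punctured neighbourhoods -/

theorem IsPreconnected.pos_or_neg {f : ℝ → ℝ} {I : Set ℝ} (hI : IsPreconnected I)
    (hf : ContinuousOn f I) (hne : ∀ x ∈ I, f x ≠ 0) : (∀ x ∈ I, 0 < f x) ∨ ∀ x ∈ I, f x < 0 := by
  by_contra! h
  obtain ⟨⟨x, hx, hfx⟩, y, hy, hfy⟩ := h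
  obtain ⟨z, hz, hfz⟩ := hI.intermediate_value hx hy hf ⟨hfx, hfy⟩
  exact hne z hz hfz

theorem eventually_sign_of_finite_zeros {f : ℝ → ℝ} {z : ℝ} (hf : ContinuousOn f (Ioo 0 1))
    (hfin : {x ∈ Ioo (0 : ℝ) 1 | f x = 0}.Finite) (hz : z ∈ Ioo (0 : ℝ) 1) :
    ((∀ᶠ x in 𝓝[<] z, 0 < f x) ∨ ∀ᶠ x in 𝓝[<] z, f x < 0) ∧
      ((∀ᶠ x in 𝓝[>] z, 0 < f x) ∨ ∀ᶠ x in 𝓝[>] z, f x < 0) := by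
  have hopen : Ioo 0 1 ∩ ({x ∈ Ioo (0 : ℝ) 1 | f x = 0} \ {z})ᶜ ∈ 𝓝 z :=
    inter_mem (isOpen_Ioo.mem_nhds hz)
      ((hfin.subset sdiff_subset).isClosed.isOpen_compl.mem_nhds (by simp))
  obtain ⟨ε, hε, hball⟩ := Metric.mem_nhds_iff.1 hopen
  rw [Real.ball_eq_Ioo] at hball
  have key : ∀ I : Set ℝ, I ⊆ Ioo (z - ε) (z + ε) → z ∉ I → IsPreconnected I →
      (∀ x ∈ I, 0 < f x) ∨ ∀ x ∈ I, f x < 0 := by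
    intro I hI hzI hpre
    refine hpre.pos_or_neg (hf.mono fun x hx => (hball (hI hx)).1) fun x hx hfx => ?_
    exact (hball (hI hx)).2 ⟨⟨(hball (hI hx)).1, hfx⟩, fun h => hzI (h ▸ hx)⟩
  constructor
  · have hI : Ioo (z - ε) z ∈ 𝓝[<] z := Ioo_mem_nhdsLT (by linarith)
    exact (key _ (Ioo_subset_Ioo_right (by linarith)) (by simp) isPreconnected_Ioo).imp
      (fun h => mem_of_superset hI h) (fun h => mem_of_superset hI h)
  · have hI : Ioo z (z + ε) ∈ 𝓝[>] z := Ioo_mem_nhdsGT (by linarith)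
    exact (key _ (Ioo_subset_Ioo_left (by linarith)) (by simp) isPreconnected_Ioo).imp
      (fun h => mem_of_superset hI h) (fun h => mem_of_superset hI h)

theorem eventually_nhdsNE_iff {p : ℝ → Prop} {z : ℝ} :
    (∀ᶠ x in 𝓝[≠] z, p x) ↔ (∀ᶠ x in 𝓝[<] z, p x) ∧ ∀ᶠ x in 𝓝[>] z, p x := by
  rw [← nhdsLT_sup_nhdsGT, eventually_sup]

theorem eventually_sign_of_ne_zero {f : ℝ → ℝ} {z : ℝ} (hf : ContinuousAt f z) (hz : f z ≠ 0) :
    (∀ᶠ x in 𝓝[≠] z, 0 < f x) ∨ ∀ᶠ x in 𝓝[≠] z, f x < 0 := by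
  rcases hz.lt_or_gt with h | h
  · exact Or.inr ((hf.eventually (gt_mem_nhds h)).filter_mono inf_le_left)
  · exact Or.inl ((hf.eventually (lt_mem_nhds h)).filter_mono inf_le_left)

/-- Away from its sign changes, a function with finitely many zeros keeps its sign. -/
theorem eventually_sign_of_not_changesSignAt {f : ℝ → ℝ} {z : ℝ} (hf : ContinuousOn f (Ioo 0 1))
    (hfin : {x ∈ Ioo (0 : ℝ) 1 | f x = 0}.Finite) (hz : z ∈ Ioo (0 : ℝ) 1)
    (hch : ¬ ChangesSignAt f z) :
    (∀ᶠ x in 𝓝[≠] z, 0 < f x) ∨ ∀ᶠ x in 𝓝[≠] z, f x < 0 := by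
  by_cases h0 : f z = 0
  · simp only [eventually_nhdsNE_iff]
    unfold ChangesSignAt at hch
    have := eventually_sign_of_finite_zeros hf hfin hz
    tauto
  · exact eventually_sign_of_ne_zero (hf.continuousAt (isOpen_Ioo.mem_nhds hz)) h0

/-- Sign changes of `U` and simple zeros of `V` are brought to the same form, a constant sign after
multiplication by `x - z`; in the product `U V` the factor `(x - z)²` is then harmless. -/
theorem ChangesSignAt.eventually_sign_mul_sub {f : ℝ → ℝ} {z : ℝ} (h : ChangesSignAt f z) :
    (∀ᶠ x in 𝓝[≠] z, 0 < f x * (x - z)) ∨ ∀ᶠ x in 𝓝[≠] z, f x * (x - z) < 0 := by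
  simp only [eventually_nhdsNE_iff]
  rcases h.2 with ⟨h1, h2⟩ | ⟨h1, h2⟩
  · left
    constructor
    · filter_upwards [h1, self_mem_nhdsWithin] with x hx hxz
      exact mul_pos_of_neg_of_neg hx (sub_neg.2 hxz)
    · filter_upwards [h2, self_mem_nhdsWithin] with x hx hxz
      exact mul_pos hx (sub_pos.2 hxz)
  · right
    constructor
    · filter_upwards [h1, self_mem_nhdsWithin] with x hx hxz
      exact mul_neg_of_pos_of_neg hx (sub_neg.2 hxz)
    · filter_upwards [h2, self_mem_nhdsWithin] with x hx hxz
      exact mul_neg_of_neg_of_pos hx (sub_pos.2 hxz)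

theorem eventually_sign_mul_sub_of_deriv_ne_zero {f : ℝ → ℝ} {z : ℝ} (hz : f z = 0)
    (hd : deriv f z ≠ 0) :
    (∀ᶠ x in 𝓝[≠] z, 0 < f x * (x - z)) ∨ ∀ᶠ x in 𝓝[≠] z, f x * (x - z) < 0 := by
  have hs := hasDerivAt_iff_tendsto_slope.1 (differentiableAt_of_deriv_ne_zero hd).hasDerivAt
  have heq : ∀ x, x ≠ z → f x * (x - z) = slope f z x * (x - z) ^ 2 := by
    intro x hx
    have := sub_ne_zero.2 hx
    rw [slope_def_field, hz]
    field_simp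
    ring
  rcases hd.lt_or_gt with h | h
  · right
    filter_upwards [hs.eventually (gt_mem_nhds h), self_mem_nhdsWithin] with x hx hxz
    rw [heq x hxz]
    exact mul_neg_of_neg_of_pos hx (sq_pos_of_ne_zero (sub_ne_zero.2 hxz))
  · left
    filter_upwards [hs.eventually (lt_mem_nhds h), self_mem_nhdsWithin] with x hx hxz
    rw [heq x hxz]
    exact mul_pos hx (sq_pos_of_ne_zero (sub_ne_zero.2 hxz))

/-- Used to split `]0,1[` by local sign: the two pieces are open, so connectedness makes the sign
global. -/
theorem isOpen_setOf_eventually_nhdsNE (p : ℝ → Prop) : IsOpen {z | ∀ᶠ x in 𝓝[≠] z, p x} := by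
  rw [isOpen_iff_mem_nhds]
  intro z hz
  have h := eventually_eventually_nhdsWithin.2 hz
  rw [eventually_nhdsWithin_iff] at h
  filter_upwards [h] with y hy
  by_cases hyz : y = z
  · exact hyz ▸ hz
  · have h2 := hy hyz
    rw [isOpen_compl_singleton.nhdsWithin_eq hyz] at h2
    exact h2.filter_mono inf_le_left

theorem not_forall_eventually_pos_of_integral_eq_zero {f : ℝ → ℝ} (hf : ContinuousOn f (Icc 0 1))
    (hint : ∫ x in (0 : ℝ)..1, f x = 0) :
    ¬ ∀ z ∈ Ioo (0 : ℝ) 1, ∀ᶠ x in 𝓝[≠] z, 0 < f x := by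
  intro h
  have hIoo : ∀ z ∈ Ioo (0 : ℝ) 1, 0 ≤ f z := by
    intro z hz
    by_contra! hneg
    have h1 : ∀ᶠ x in 𝓝[≠] z, f x < 0 := ((hf.continuousAt (Icc_mem_nhds hz.1 hz.2)).eventually
      (gt_mem_nhds hneg)).filter_mono inf_le_left
    obtain ⟨x, hx1, hx2⟩ := (h1.and (h z hz)).exists
    exact lt_asymm hx1 hx2
  have hIcc : ∀ z ∈ Icc (0 : ℝ) 1, 0 ≤ f z := by
    intro z hz
    have hcl : z ∈ closure (Ioo (0 : ℝ) 1) := by rwa [closure_Ioo zero_ne_one]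
    have := mem_closure_iff_nhdsWithin_neBot.1 hcl
    exact ge_of_tendsto ((hf z hz).mono Ioo_subset_Icc_self)
      (eventually_mem_nhdsWithin.mono hIoo)
  have hhalf : (1 / 2 : ℝ) ∈ Ioo (0 : ℝ) 1 := by norm_num
  obtain ⟨c, hc, hc2⟩ := ((h _ hhalf).and
    (eventually_nhdsWithin_of_eventually_nhds (isOpen_Ioo.eventually_mem hhalf))).exists
  exact (intervalIntegral.integral_pos one_pos hf (fun x hx => hIcc x (Ioc_subset_Icc_self hx))
    ⟨c, Ioo_subset_Icc_self hc2, hc⟩).ne' hint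

/-- A continuous function on `[0,1]` with integral zero cannot have a constant sign around every
point of `]0,1[`. -/
theorem exists_not_eventually_sign_of_integral_eq_zero {f : ℝ → ℝ}
    (hf : ContinuousOn f (Icc 0 1)) (hint : ∫ x in (0 : ℝ)..1, f x = 0) :
    ∃ z ∈ Ioo (0 : ℝ) 1, ¬ ((∀ᶠ x in 𝓝[≠] z, 0 < f x) ∨ ∀ᶠ x in 𝓝[≠] z, f x < 0) := by
  by_contra! h
  have hpos := not_forall_eventually_pos_of_integral_eq_zero hf hint
  have hneg := not_forall_eventually_pos_of_integral_eq_zero (f := fun x => -f x) hf.neg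
    (by simp [hint])
  simp only [Left.neg_pos_iff] at hneg
  push Not at hpos hneg
  obtain ⟨x, hx, hxp⟩ := hpos
  obtain ⟨y, hy, hyn⟩ := hneg
  obtain ⟨z, hz, hz1, hz2⟩ := isPreconnected_Ioo (a := (0 : ℝ)) (b := 1)
    {z | ∀ᶠ x in 𝓝[≠] z, 0 < f x} {z | ∀ᶠ x in 𝓝[≠] z, f x < 0}
    (isOpen_setOf_eventually_nhdsNE _) (isOpen_setOf_eventually_nhdsNE _) (fun z hz => h z hz)
    ⟨y, hy, (h y hy).resolve_right (by simpa using hyn)⟩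
    ⟨x, hx, (h x hx).resolve_left (by simpa using hxp)⟩
  rw [mem_ofPred_eq] at hz1 hz2
  have hev : ∀ᶠ x in 𝓝[≠] z, 0 < f x ∧ f x < 0 := hz1.and hz2
  obtain ⟨t, ht1, ht2⟩ := hev.exists
  exact lt_asymm ht1 ht2

theorem Filter.Eventually.sign_mul {l : Filter ℝ} {f g w : ℝ → ℝ}
    (hf : (∀ᶠ x in l, 0 < f x * w x) ∨ ∀ᶠ x in l, f x * w x < 0)
    (hg : (∀ᶠ x in l, 0 < g x * w x) ∨ ∀ᶠ x in l, g x * w x < 0) :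
    (∀ᶠ x in l, 0 < f x * g x) ∨ ∀ᶠ x in l, f x * g x < 0 := by
  have hw : ∀ x, f x * w x * (g x * w x) = f x * g x * w x ^ 2 := fun x => by ring
  rcases hf with hf | hf <;> rcases hg with hg | hg
  · left
    filter_upwards [hf, hg] with x h1 h2
    exact pos_of_mul_pos_left (hw x ▸ mul_pos h1 h2) (sq_nonneg _)
  · right
    filter_upwards [hf, hg] with x h1 h2
    exact neg_of_mul_neg_left (hw x ▸ mul_neg_of_pos_of_neg h1 h2) (sq_nonneg _)
  · right
    filter_upwards [hf, hg] with x h1 h2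
    exact neg_of_mul_neg_left (hw x ▸ mul_neg_of_neg_of_pos h1 h2) (sq_nonneg _)
  · left
    filter_upwards [hf, hg] with x h1 h2
    exact pos_of_mul_pos_left (hw x ▸ mul_pos_of_neg_of_neg h1 h2) (sq_nonneg _)

/-! ### The lower bound on sign changes, and the conclusion -/

/-- If `f` has at most `#S` zeros counted with multiplicities and vanishes on `S`, then its zeros
are simple and form `S`. -/
theorem simple_zeros_of_zeroCount_le {f : ℝ → ℝ} {S : Finset ℝ} (hS : (S : Set ℝ) ⊆ Ioo 0 1)
    (hz : ∀ x ∈ S, f x = 0) (hcount : zeroCount f (Ioo 0 1) ≤ S.card) :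
    (∀ x ∈ S, deriv f x ≠ 0) ∧ ∀ x ∈ Ioo (0 : ℝ) 1, x ∉ S → f x ≠ 0 := by
  classical
  have hlt : ¬ (S.card : ℕ∞) + 1 ≤ S.card := by
    intro h
    have : S.card + 1 ≤ S.card := by exact_mod_cast h
    omega
  refine ⟨fun x hx hd => hlt ?_, fun x hx hxS hfx => hlt ?_⟩
  · calc (S.card : ℕ∞) + 1 = (S.erase x).card + 2 := by
          rw [← Finset.card_erase_add_one hx, Nat.cast_add, add_assoc]
          norm_num
      _ ≤ ∑ y ∈ S.erase x, zeroMultiplicity f y + zeroMultiplicity f x :=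
          add_le_add (card_le_sum_zeroMultiplicity fun y hy => hz y (Finset.mem_of_mem_erase hy))
            (two_le_zeroMultiplicity (hz x hx) hd)
      _ = ∑ y ∈ S, zeroMultiplicity f y := Finset.sum_erase_add _ _ hx
      _ ≤ S.card := (sum_zeroMultiplicity_le_zeroCount hS).trans hcount
  · calc (S.card : ℕ∞) + 1 = (insert x S).card := by
          rw [Finset.card_insert_of_notMem hxS]; simp
      _ ≤ ∑ y ∈ insert x S, zeroMultiplicity f y := card_le_sum_zeroMultiplicity fun y hy => by
          rcases Finset.mem_insert.1 hy with rfl | hy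
          · exact hfx
          · exact hz y hy
      _ ≤ S.card := (sum_zeroMultiplicity_le_zeroCount (by
          rw [Finset.coe_insert]
          exact insert_subset hx hS)).trans hcount

theorem le_encard_changesSignAt {q : ℝ → ℝ} {m n : ℕ} (hqc : ContinuousOn q (Icc 0 1))
    (hq : ContDiffOn ℝ ∞ q (Ioo 0 1)) (hm : 1 ≤ m) (hmn : m ≤ n)
    {lam : ℕ → ℝ} {h : ℕ → ℝ → ℝ}
    (hlam : ∀ k ∈ Finset.Icc m n, IsKthDirichletEigenvalue q k (lam k))
    (hh : ∀ k ∈ Finset.Icc m n, IsDirichletEigenfunction q (lam k) (h k))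
    {a : ℕ → ℝ} (ha : ∃ k ∈ Finset.Icc m n, a k ≠ 0) :
    ((m - 1 : ℕ) : ℕ∞) ≤ {z : ℝ | z ∈ Ioo (0 : ℝ) 1 ∧
      ChangesSignAt (fun x => ∑ k ∈ Finset.Icc m n, a k * h k x) z}.encard := by
  by_contra! hlt
  set U : ℝ → ℝ := fun x => ∑ k ∈ Finset.Icc m n, a k * h k x with hU
  obtain ⟨p, hp⟩ := ENat.ne_top_iff_exists.1 hlt.ne_top
  rw [← hp] at hlt
  have hpm : p < m - 1 := by exact_mod_cast hlt
  have hSfin : {z : ℝ | z ∈ Ioo (0 : ℝ) 1 ∧ ChangesSignAt U z}.Finite :=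
    finite_of_encard_eq_coe hp.symm
  set S := hSfin.toFinset with hSdef
  have hScard : S.card = p := by
    rw [hSfin.encard_eq_coe_toFinset_card] at hp
    exact_mod_cast hp.symm
  have hSmem : ∀ z, z ∈ S ↔ z ∈ Ioo (0 : ℝ) 1 ∧ ChangesSignAt U z := fun z => by
    simp [hSdef]
  have hmm : m ∈ Finset.Icc m n := Finset.mem_Icc.2 ⟨le_rfl, hmn⟩
  have hex : ∀ i ∈ Finset.Icc 1 (p + 1), ∃ mu, IsKthDirichletEigenvalue q i mu := fun i hi =>
    (hlam m hmm).exists_lower (Finset.mem_Icc.1 hi).1 (by have := (Finset.mem_Icc.1 hi).2; omega)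
  choose! mu hmu using hex
  have hex2 : ∀ i ∈ Finset.Icc 1 (p + 1), ∃ y, IsDirichletEigenfunction q (mu i) y :=
    fun i hi => (hmu i hi).1
  choose! g hg using hex2
  -- There are `p` conditions and `p + 1` unknowns. Since `p + 1 < m`, all the test eigenfunctions
  -- are orthogonal to those in `U`, and the upper bound allows `V` exactly the `p` zeros in `S`.
  obtain ⟨b, hb, hbS⟩ := exists_linearCombination_vanishing (Finset.Icc 1 (p + 1)) S
    (by simp [hScard]) g
  set V : ℝ → ℝ := fun x => ∑ i ∈ Finset.Icc 1 (p + 1), b i * g i x with hV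
  have hVcount : zeroCount V (Ioo 0 1) ≤ S.card := by
    have := zeroCount_linearCombination_add_one_le hqc hq (fun k hk => (Finset.mem_Icc.1 hk).1)
      (fun k hk => (Finset.mem_Icc.1 hk).2) hmu hg b hb
    rw [hScard]
    push_cast at this
    exact (ENat.add_le_add_iff_right (by simp)).1 this
  obtain ⟨hVsimple, hVne⟩ := simple_zeros_of_zeroCount_le
    (fun z hz => ((hSmem z).1 hz).1) hbS hVcount
  -- The upper bound applied to `U` itself: its zeros are isolated, so it has a definite sign on
  -- each side of every point.
  have hUfin : {x ∈ Ioo (0 : ℝ) 1 | U x = 0}.Finite :=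
    finite_of_encard_le_coe (k := n) ((encard_zeros_le_zeroCount _ _).trans
      (le_self_add.trans (zeroCount_linearCombination_add_one_le hqc hq
        (fun k hk => hm.trans (Finset.mem_Icc.1 hk).1)
        (fun k hk => (Finset.mem_Icc.1 hk).2) hlam hh a ha)))
  have hUc : ContinuousOn U (Icc 0 1) := continuousOn_finsetSum _ fun k hk =>
    continuousOn_const.mul (hh k hk).contDiffOn.continuousOn
  have hVc : ContinuousOn V (Icc 0 1) := continuousOn_finsetSum _ fun k hk =>
    continuousOn_const.mul (hg k hk).contDiffOn.continuousOn
  have hterm : ∀ k ∈ Finset.Icc m n, ∀ i ∈ Finset.Icc 1 (p + 1),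
      ∫ x in (0 : ℝ)..1, h k x * g i x = 0 := by
    intro k hk i hi
    obtain ⟨d, hd⟩ := (hh k hk).exists_isSolutionPair hqc
    obtain ⟨e, he⟩ := (hg i hi).exists_isSolutionPair hqc
    refine integral_mul_eigenfunctions_eq_zero hd he ((hmu i hi).lt (hlam k hk) ?_).ne'
      (hh k hk).left (hh k hk).right (hg i hi).left (hg i hi).right
    have h1 := (Finset.mem_Icc.1 hk).1
    have h2 := (Finset.mem_Icc.1 hi).2
    omega
  have hint : ∫ x in (0 : ℝ)..1, U x * V x = 0 := by
    have hi1 : ∀ k ∈ Finset.Icc m n, ∀ i ∈ Finset.Icc 1 (p + 1), IntervalIntegrable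
        (fun x => a k * b i * (h k x * g i x)) MeasureTheory.volume 0 1 := fun k hk i hi =>
      ContinuousOn.intervalIntegrable_of_Icc zero_le_one (continuousOn_const.mul
        ((hh k hk).contDiffOn.continuousOn.mul (hg i hi).contDiffOn.continuousOn))
    have hexp : ∀ x, U x * V x = ∑ k ∈ Finset.Icc m n, ∑ i ∈ Finset.Icc 1 (p + 1),
        a k * b i * (h k x * g i x) := by
      intro x
      simp only [hU, hV, Finset.sum_mul_sum]
      exact Finset.sum_congr rfl fun k _ => Finset.sum_congr rfl fun i _ => by ring
    simp only [hexp]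
    rw [intervalIntegral.integral_finsetSum fun k hk => by
      simpa only [Finset.sum_fn] using IntervalIntegrable.sum _ (hi1 k hk)]
    refine Finset.sum_eq_zero fun k hk => ?_
    rw [intervalIntegral.integral_finsetSum (hi1 k hk)]
    refine Finset.sum_eq_zero fun i hi => ?_
    rw [intervalIntegral.integral_const_mul, hterm k hk i hi, mul_zero]
  obtain ⟨z, hz, hzn⟩ := exists_not_eventually_sign_of_integral_eq_zero (hUc.mul hVc) hint
  refine hzn ?_
  -- On `S` both factors reverse sign; elsewhere neither does. Either way `U V` has a constant sign
  -- around `z`.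
  by_cases hzS : z ∈ S
  · exact Filter.Eventually.sign_mul ((hSmem z).1 hzS).2.eventually_sign_mul_sub
      (eventually_sign_mul_sub_of_deriv_ne_zero (hbS z hzS) (hVsimple z hzS))
  · have h1 := eventually_sign_of_not_changesSignAt (hUc.mono Ioo_subset_Icc_self) hUfin hz
      fun hch => hzS ((hSmem z).2 ⟨hz, hch⟩)
    have h2 := eventually_sign_of_ne_zero (hVc.continuousAt (Icc_mem_nhds hz.1 hz.2))
      (hVne z hz hzS)
    exact Filter.Eventually.sign_mul (w := fun _ => 1) (by simpa using h1) (by simpa using h2)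

theorem theorem1p1
    (q : ℝ → ℝ) (V : Set ℝ) (hV : IsOpen V) (hIV : Icc (0 : ℝ) 1 ⊆ V)
    (hq : ContDiffOn ℝ ∞ q V)
    (m n : ℕ) (hm : 1 ≤ m) (hmn : m ≤ n)
    (lam : ℕ → ℝ) (h : ℕ → ℝ → ℝ)
    (hlam : ∀ k ∈ Finset.Icc m n, IsKthDirichletEigenvalue q k (lam k))
    (hh : ∀ k ∈ Finset.Icc m n, IsDirichletEigenfunction q (lam k) (h k))
    (a : ℕ → ℝ) (ha : ∃ k ∈ Finset.Icc m n, a k ≠ 0) :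
    zeroCount (fun x => ∑ k ∈ Finset.Icc m n, a k * h k x) (Ioo 0 1) ≤ ((n - 1 : ℕ) : ℕ∞) ∧
      ((m - 1 : ℕ) : ℕ∞) ≤
        {z : ℝ | z ∈ Ioo (0 : ℝ) 1 ∧
          ChangesSignAt (fun x => ∑ k ∈ Finset.Icc m n, a k * h k x) z}.encard := by
  have hqc : ContinuousOn q (Icc 0 1) := hq.continuousOn.mono hIV
  have hqs : ContDiffOn ℝ ∞ q (Ioo 0 1) := hq.mono (Ioo_subset_Icc_self.trans hIV)
  refine ⟨?_, le_encard_changesSignAt hqc hqs hm hmn hlam hh ha⟩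
  have h1 := zeroCount_linearCombination_add_one_le hqc hqs
    (fun k hk => hm.trans (Finset.mem_Icc.1 hk).1) (fun k hk => (Finset.mem_Icc.1 hk).2)
    hlam hh a ha
  have hn : (n : ℕ∞) = ((n - 1 : ℕ) : ℕ∞) + 1 := by
    exact_mod_cast (Nat.sub_add_cancel (hm.trans hmn)).symm
  exact (ENat.add_le_add_iff_right (by simp)).1 (h1.trans_eq hn)
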